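/- Setting. Let $\Theta$ be a compact metric space and let $(\mathsf X,\mathcal X)$, $(\mathsf Y,\mathcal Y)$ be measurable spaces. For each $\theta\in\Theta$ let $Q^\theta$ be a Markov transition kernel on $\mathsf X$ and let $g^\theta:\mathsf X\times\mathsf Y\to[0,\infty)$ be measurable. Let $(Y_k)_{k\in\mathbb Z}$ be a stationary ergodic process with values in $\mathsf Y$ on a probability space $(\Omega,\mathcal F,\mathbb P)$; its law need not be related to the family $(Q^\theta,g^\theta)_{\theta\in\Theta}$. For a sequence $(a_k)$ write $a_m^n=(a_m,\dots,a_n)$. For a probability measure $\chi$ on $\mathsf X$ put $$p^\theta_\chi(y_m^n)=\int\cdots\int\chi(dx_m)\,g^\theta(x_m,y_m)\prod_{p=m+1}^nQ^\theta(x_{p-1},dx_p)\,g^\theta(x_p,y_p),\qquad p^\theta_\chi(y_p^n\mid y_m^{p-1})=\frac{p^\theta_\chi(y_m^n)}{p^\theta_\chi(y_m^{p-1})},$$ and $p^\theta_x=p^\theta_{\delta_x}$. For $t\ge1$ let $\mathbf L^\theta\langle y_0^{t-1}\rangle$ be the unnormalized kernel $$\mathbf L^\theta\langle y_0^{t-1}\rangle(x_0,A)=\int\cdots\int\Big[\prod_{i=0}^{t-1}g^\theta(x_i,y_i)\,Q^\theta(x_i,dx_{i+1})\Big]\mathbf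 1_A(x_t).$$ Write $\ln^+a=\max(\ln a,0)$ and $\ln^-a=\max(-\ln a,0)$ for $a\in[0,\infty]$. A set $C\in\mathcal X$ is an $r$-local Doeblin set if there are functions $\epsilon_C^-,\epsilon_C^+:\mathsf Y^r\to(0,\infty)$, probability measures $\lambda^\theta_C\langle z\rangle$ on $\mathsf X$ with $\lambda^\theta_C\langle z\rangle(C)=1$ and functions $\varphi^\theta_C\langle z\rangle:\mathsf X\to(0,\infty)$ ($\theta\in\Theta$, $z\in\mathsf Y^r$) such that for all $\theta\in\Theta$, $z\in\mathsf Y^r$, $A\in\mathcal X$ and $x\in C$, $$\epsilon_C^-(z)\,\varphi_C^\theta\langle z\rangle(x)\,\lambda_C^\theta\langle z\rangle(A)\le\mathbf L^\theta\langle z\rangle(x,A\cap C)\le\epsilon_C^+(z)\,\varphi_C^\theta\langle z\rangle(x)\,\lambda_C^\theta\langle z\rangle(A).$$ Assumptions. (A1) An integer $r\ge1$, a set $K\in\mathcal Y^{\otimes r}$ and a set $D\in\mathcal X$ are given such that: (i) $\mathbb P(Y_0^{r-1}\in K)>2/3$; (ii) for every $\eta>0$ there is an $r$-local Doeblin set $C$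 such that, for all $\theta\in\Theta$ and $y_0^{r-1}\in K$, $\sup_{x\in C^c}p^\theta_x(y_0^{r-1})\le\eta\sup_{x\in\mathsf X}p^\theta_x(y_0^{r-1})<\infty$, and $\inf_{z\in K}\epsilon_C^-(z)/\epsilon_C^+(z)>0$; (iii) $\mathbb E\big[\ln^-\inf_{\theta\in\Theta}\inf_{x\in D}\mathbf L^\theta\langle Y_0^{r-1}\rangle(x,D)\big]<\infty$. (A2) (i) $g^\theta(x,y)>0$ for all $\theta,x,y$; (ii) $\mathbb E\big[\ln^+\sup_{\theta\in\Theta}\sup_{x\in\mathsf X}g^\theta(x,Y_0)\big]<\infty$. Let $\mathcal M(D,r)$ be the set of probability measures $\chi$ on $\mathsf X$ such that $\mathbb E\big[\ln^-\inf_{\theta\in\Theta}\int\chi(dx)\,\mathbf L^\theta\langle Y_0^{u-1}\rangle(x,D)\big]<\infty$ for all $u\in\{1,\dots,r\}$. (Where the suprema and infima above are not measurable, $\mathbb E[\,\cdot\,]<\infty$ means that the function of the observations inside is dominated, almost surely for their law, by a measurable function of them with finite expectation.) Claim. Assume (A1) and (A2), and let $\theta\in\Theta$. Then: (i) there is a measurable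 function $\pi^\theta_Y:\mathsf Y^{\mathbb Z^-}\to\mathbb R$, $\mathbb Z^-=\{\dots,-1,0\}$, such that for every $\chi\in\mathcal M(D,r)$, $\mathbb P$-a.s., $p^\theta_\chi(Y_0\mid Y_{-m}^{-1})\to\pi^\theta_Y(Y_{-\infty}^0)$ as $m\to\infty$; moreover $\pi^\theta_Y(Y_{-\infty}^0)>0$ $\mathbb P$-a.s. and $\mathbb E\,|\ln\pi^\theta_Y(Y_{-\infty}^0)|<\infty$; (ii) for every $\chi\in\mathcal M(D,r)$, $\mathbb P$-a.s., $n^{-1}\ln p^\theta_\chi(Y_0^{n-1})\to\ell(\theta)$ as $n\to\infty$, where $\ell(\theta)=\mathbb E[\ln\pi^\theta_Y(Y_{-\infty}^0)]$. -/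

import Mathlib

open MeasureTheory ProbabilityTheory Filter Topology
open scoped NNReal ENNReal

namespace HMM

noncomputable section

/-- Negative part of the logarithm, `ln⁻ a = max (-ln a) 0`, with `ln⁻ 0 = ∞`. -/
def lnNeg (a : ℝ≥0∞) : ℝ≥0∞ := (-ENNReal.log a).toENNReal

/-- Positive part of the logarithm, `ln⁺ a = max (ln a) 0`, with `ln⁺ ∞ = ∞`. -/
def lnPos (a : ℝ≥0∞) : ℝ≥0∞ := (ENNReal.log a).toENNReal

/-- `F` has finite (outer) expectation under `ν`: it is dominated by a measurable function with
finite integral. For `ν`-measurable `F` this is `∫ F dν < ∞`, see `finiteMean_iff`; the outer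
expectation makes sense of suprema and infima over uncountable index sets. -/
def FiniteMean {S : Type*} [MeasurableSpace S] (ν : Measure S) (F : S → ℝ≥0∞) : Prop :=
  ∃ H : S → ℝ≥0∞, Measurable H ∧ (∀ᵐ s ∂ν, F s ≤ H s) ∧ ∫⁻ s, H s ∂ν < ∞

theorem finiteMean_iff {S : Type*} [MeasurableSpace S] {ν : Measure S} {F : S → ℝ≥0∞}
    (hF : AEMeasurable F ν) : FiniteMean ν F ↔ ∫⁻ s, F s ∂ν < ∞ := by
  constructor
  · rintro ⟨H, -, hle, hH⟩
    exact (lintegral_mono_ae hle).trans_lt hH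
  · intro h
    exact ⟨hF.mk F, hF.measurable_mk, hF.ae_eq_mk.le,
      (lintegral_congr_ae hF.ae_eq_mk).symm ▸ h⟩

/-- The block `(y_m, y_{m+1}, …, y_{m+t-1})` of length `t` of a two-sided sequence. -/
def block {𝓨 : Type*} (y : ℤ → 𝓨) (m : ℤ) (t : ℕ) : Fin t → 𝓨 := fun i => y (m + (i : ℕ))

/-- The shift on two-sided sequences. -/
def shift {𝓨 : Type*} (y : ℤ → 𝓨) : ℤ → 𝓨 := fun k => y (k + 1)

/-- `(Y_k)_{k ∈ ℤ}` is a stationary ergodic process: its law on the product space is invariant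
and ergodic for the shift. -/
def IsStationaryErgodic {Ω 𝓨 : Type*} [MeasurableSpace Ω] [MeasurableSpace 𝓨]
    (P : Measure Ω) (Y : ℤ → Ω → 𝓨) : Prop :=
  (∀ k, Measurable (Y k)) ∧ Ergodic shift (P.map fun ω k => Y k ω)

section Model

variable {𝓧 𝓨 : Type*} [MeasurableSpace 𝓧]

/-- Likelihood of `(y_0, …, y_{t-1})` for the hidden chain started at `x`:
`g(x, y_0) ∫ Q(x, dx_1) g(x_1, y_1) ⋯ ∫ Q(x_{t-2}, dx_{t-1}) g(x_{t-1}, y_{t-1})`. -/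
def likelihoodFrom (Q : Kernel 𝓧 𝓧) (g : 𝓧 → 𝓨 → ℝ≥0) : (t : ℕ) → (Fin t → 𝓨) → 𝓧 → ℝ≥0∞
  | 0, _, _ => 1
  | 1, y, x => g x (y 0)
  | t + 2, y, x => g x (y 0) * ∫⁻ x', likelihoodFrom Q g (t + 1) (Fin.tail y) x' ∂(Q x)

/-- Likelihood `p_χ(y_0, …, y_{t-1})` for the initial distribution `χ`. -/
def likelihood (Q : Kernel 𝓧 𝓧) (g : 𝓧 → 𝓨 → ℝ≥0) (χ : Measure 𝓧) {t : ℕ} (y : Fin t → 𝓨) :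
    ℝ≥0∞ :=
  ∫⁻ x, likelihoodFrom Q g t y x ∂χ

/-- One-step predictive density
`p_χ(y_0 | y_{-m}, …, y_{-1}) = p_χ(y_{-m}, …, y_0) / p_χ(y_{-m}, …, y_{-1})`. -/
def predictive (Q : Kernel 𝓧 𝓧) (g : 𝓧 → 𝓨 → ℝ≥0) (χ : Measure 𝓧) (y : ℤ → 𝓨) (m : ℕ) : ℝ≥0∞ :=
  likelihood Q g χ (block y (-m) (m + 1)) / likelihood Q g χ (block y (-m) m)

/-- Action on nonnegative functions of the unnormalized kernel `L⟨y_0, …, y_{t-1}⟩`: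
`f ↦ ∫ ⋯ ∫ [∏_{i < t} g(x_i, y_i) Q(x_i, dx_{i+1})] f(x_t)`. -/
def blockOp (Q : Kernel 𝓧 𝓧) (g : 𝓧 → 𝓨 → ℝ≥0) :
    (t : ℕ) → (Fin t → 𝓨) → (𝓧 → ℝ≥0∞) → 𝓧 → ℝ≥0∞
  | 0, _, f, x => f x
  | t + 1, y, f, x => g x (y 0) * ∫⁻ x', blockOp Q g t (Fin.tail y) f x' ∂(Q x)

/-- The unnormalized kernel `L⟨y_0, …, y_{t-1}⟩(x, A)`. -/
def blockKernel (Q : Kernel 𝓧 𝓧) (g : 𝓧 → 𝓨 → ℝ≥0) {t : ℕ} (y : Fin t → 𝓨) (x : 𝓧)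
    (A : Set 𝓧) : ℝ≥0∞ :=
  blockOp Q g t y (A.indicator 1) x

variable {Θ : Type*}

/-- `C` is an `r`-local Doeblin set for the family `(Q θ, g θ)`, with lower and upper
functions `εm` and `εp` (which do not depend on `θ`). -/
def IsLocalDoeblin (Q : Θ → Kernel 𝓧 𝓧) (g : Θ → 𝓧 → 𝓨 → ℝ≥0) (r : ℕ) (C : Set 𝓧)
    (εm εp : (Fin r → 𝓨) → ℝ≥0) : Prop :=
  MeasurableSet C ∧ (∀ z, 0 < εm z) ∧ (∀ z, 0 < εp z) ∧
  ∃ (lam : Θ → (Fin r → 𝓨) → ProbabilityMeasure 𝓧) (φ : Θ → (Fin r → 𝓨) → 𝓧 → ℝ≥0),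
    (∀ θ z x, 0 < φ θ z x) ∧
    ∀ θ z, (lam θ z : Measure 𝓧) C = 1 ∧
      ∀ A, MeasurableSet A → ∀ x ∈ C,
        (εm z : ℝ≥0∞) * φ θ z x * (lam θ z : Measure 𝓧) A
            ≤ blockKernel (Q θ) (g θ) z x (A ∩ C) ∧
        blockKernel (Q θ) (g θ) z x (A ∩ C)
            ≤ (εp z : ℝ≥0∞) * φ θ z x * (lam θ z : Measure 𝓧) A

variable [MeasurableSpace 𝓨] {Ω : Type*} [MeasurableSpace Ω]

/-- Law of `(Y_0, …, Y_{t-1})`. -/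
def blockLaw (P : Measure Ω) (Y : ℤ → Ω → 𝓨) (t : ℕ) : Measure (Fin t → 𝓨) :=
  P.map fun ω => block (fun k => Y k ω) 0 t

/-- Assumption (A1), for the integer `r`, the set `K` of blocks and the set `D` of states. -/
structure AssumptionA1 (Q : Θ → Kernel 𝓧 𝓧) (g : Θ → 𝓧 → 𝓨 → ℝ≥0) (P : Measure Ω)
    (Y : ℤ → Ω → 𝓨) (r : ℕ) (K : Set (Fin r → 𝓨)) (D : Set 𝓧) : Prop where
  one_le : 1 ≤ r
  measurableSet_K : MeasurableSet K
  prob_K : 2 / 3 < P {ω | block (fun k => Y k ω) 0 r ∈ K}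
  localDoeblin : ∀ η : ℝ≥0, 0 < η → ∃ (C : Set 𝓧) (εm εp : (Fin r → 𝓨) → ℝ≥0),
    IsLocalDoeblin Q g r C εm εp ∧
    (∀ θ, ∀ y ∈ K,
      (⨆ x ∈ Cᶜ, likelihood (Q θ) (g θ) (Measure.dirac x) y)
          ≤ η * ⨆ x, likelihood (Q θ) (g θ) (Measure.dirac x) y ∧
      η * (⨆ x, likelihood (Q θ) (g θ) (Measure.dirac x) y) < ∞) ∧
    0 < ⨅ y ∈ K, (εm y : ℝ≥0∞) / εp y
  measurableSet_D : MeasurableSet D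
  minoration : FiniteMean (blockLaw P Y r)
    fun y => lnNeg (⨅ θ, ⨅ x ∈ D, blockKernel (Q θ) (g θ) y x D)

/-- Assumption (A2). -/
structure AssumptionA2 (g : Θ → 𝓧 → 𝓨 → ℝ≥0) (P : Measure Ω) (Y : ℤ → Ω → 𝓨) : Prop where
  pos : ∀ θ x y, 0 < g θ x y
  lnPos_sup : FiniteMean (P.map (Y 0)) fun y => lnPos (⨆ θ, ⨆ x, (g θ x y : ℝ≥0∞))

/-- The class `M(D, r)` of initial distributions: `𝔼[ln⁻ inf_θ χ L⟨Y_0, …, Y_{u-1}⟩ 1_D] < ∞`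
for all `u ∈ {1, …, r}`. -/
def initialClass (Q : Θ → Kernel 𝓧 𝓧) (g : Θ → 𝓧 → 𝓨 → ℝ≥0) (P : Measure Ω)
    (Y : ℤ → Ω → 𝓨) (D : Set 𝓧) (r : ℕ) : Set (ProbabilityMeasure 𝓧) :=
  {χ | ∀ u ∈ Finset.Icc 1 r, FiniteMean (blockLaw P Y u)
    fun y => lnNeg (⨅ θ, ∫⁻ x, blockKernel (Q θ) (g θ) y x D ∂(χ : Measure 𝓧))}

end Model

end

end HMM

/-! Let `V` and `v` be the likelihoods of a window of lengths `N + 1` and `N`, as functions of the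
initial state. The predictive density for `χ` is `χV / χv`, so forgetting the initial law means that
`V x * v x'` is nearly unchanged when `x` and `x'` are exchanged.

Run two independent copies of the hidden chain, block by block. Over a block in `K`, started in `C ×
C`, the product kernel dominates a product of multiples of one measure; that part is invariant under
exchange and contributes no defect, and what remains on `C × C` has at most a fraction `1 - τ²` of
the mass. Being outside `C × C` at the start of such a block costs a factor `η`. With a budget of
`b` visits outside, the defect is a multiplicative error `ρ ^ (pairs - 2b)` plus an additive error
`η ^ b` times suprema (`iterKernel_mul_le`). Asymptotically fewer than a third of the blocks lie
outside `K`, so consecutive good blocks have positive density and `b` may be linear in `N`; as `η`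
is arbitrary, the additive error beats any prescribed exponential
(`RegularPath.exists_windowLik_mul_le`). Exponential lower bounds on the likelihood, obtained by
staying in `D`, absorb it into the multiplicative error (`RegularPath.exists_abs_logLik_sub_le`).
The linear growth that this needs holds on almost every path by the ergodic theorem
(`exists_weight`).

Comparing `χ` with its one-step propagation makes the log-predictive densities Cauchy in the past,
at a rate that also makes them asymptotic to the shifted limits in the future
(`RegularPath.exists_limit_logPred`). Cesàro averaging and Birkhoff's theorem then give the
normalized log-likelihood. The limit is bounded above by an integrable weight, and its Birkhoff sums
decrease at most linearly because the log-likelihood does; this yields integrability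
(`integrable_of_birkhoffSum_ge`). -/

namespace HMM

noncomputable section

/-! ### Birkhoff's ergodic theorem. -/

section Birkhoff

variable {α : Type*}

/-- The running maximum `max_{0 ≤ k ≤ n} S_k f` of the Birkhoff sums of `f`. -/
def birkhoffMax (T : α → α) (f : α → ℝ) : ℕ → α → ℝ
  | 0, _ => 0
  | n + 1, x => max 0 (f x + birkhoffMax T f n (T x))

theorem birkhoffMax_nonneg (T : α → α) (f : α → ℝ) (n : ℕ) (x : α) : 0 ≤ birkhoffMax T f n x := by
  cases n with
  | zero => exact le_rfl
  | succ n => exact le_max_left _ _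

theorem birkhoffMax_mono_succ (T : α → α) (f : α → ℝ) (n : ℕ) (x : α) :
    birkhoffMax T f n x ≤ birkhoffMax T f (n + 1) x := by
  induction n generalizing x with
  | zero => exact birkhoffMax_nonneg T f 1 x
  | succ n ih => exact max_le_max le_rfl (by gcongr; exact ih (T x))

theorem birkhoffSum_le_birkhoffMax (T : α → α) (f : α → ℝ) (n : ℕ) (x : α) :
    birkhoffSum T f n x ≤ birkhoffMax T f n x := by
  induction n generalizing x with
  | zero => simp [birkhoffSum, birkhoffMax]
  | succ n ih =>
    rw [birkhoffSum_succ']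
    exact (by gcongr; exact ih (T x) : _ ≤ f x + birkhoffMax T f n (T x)).trans (le_max_right _ _)

variable [MeasurableSpace α] {μ : Measure α}

theorem measurable_birkhoffMax {T : α → α} (hT : Measurable T) {f : α → ℝ} (hf : Measurable f)
    (n : ℕ) : Measurable (birkhoffMax T f n) := by
  induction n with
  | zero => exact measurable_const
  | succ n ih => exact measurable_const.max (hf.add (ih.comp hT))

theorem integrable_birkhoffMax {T : α → α} (hT : MeasurePreserving T μ μ) {f : α → ℝ}
    (hf : Integrable f μ) (n : ℕ) : Integrable (birkhoffMax T f n) μ := by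
  induction n with
  | zero => exact integrable_zero _ _ _
  | succ n ih => exact (integrable_zero _ _ _).sup (hf.add (hT.integrable_comp_of_integrable ih))

/-- Maximal ergodic inequality in the form used below: if the mean is negative, the Birkhoff sums
are bounded above. -/
theorem ae_bddAbove_birkhoffMax [IsProbabilityMeasure μ] {T : α → α} (hT : Ergodic T μ)
    {f : α → ℝ} (hfm : Measurable f) (hf : Integrable f μ) (hneg : ∫ x, f x ∂μ < 0) :
    ∀ᵐ x ∂μ, BddAbove (Set.range fun n => birkhoffMax T f n x) := by
  set E := {x | BddAbove (Set.range fun n => birkhoffMax T f n x)} with hE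
  have hEm : MeasurableSet E :=
    measurableSet_bddAbove_range fun n => measurable_birkhoffMax hT.measurable hfm n
  have hinv : T ⁻¹' E = E := by
    ext x
    simp only [hE, Set.mem_preimage, Set.mem_ofPred_eq, BddAbove, Set.Nonempty, upperBounds,
      Set.mem_range, forall_exists_index, forall_apply_eq_imp_iff]
    constructor
    · rintro ⟨B, hB⟩
      refine ⟨max 0 (f x + B), fun n => (birkhoffMax_mono_succ T f n x).trans ?_⟩
      exact max_le_max le_rfl (by gcongr; exact hB n)
    · rintro ⟨B, hB⟩
      refine ⟨B - f x, fun n => ?_⟩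
      have := (le_max_right 0 (f x + birkhoffMax T f n (T x))).trans (hB (n + 1))
      linarith
  rcases hT.toPreErgodic.ae_mem_or_ae_notMem hEm hinv with h | h
  · exact h
  exfalso
  -- Let `M n` be the running maxima. If they are a.e. unbounded, `M (n+1) - M n ∘ T = max (-M n ∘
  -- T) f` converges to `f`, dominated by `|f|`. Its integral is `∫ M (n+1) - ∫ M n ≥ 0`, which
  -- contradicts `∫ f < 0`.
  have hlim : ∀ᵐ x ∂μ, Tendsto (fun n => max (-birkhoffMax T f n (T x)) (f x)) atTop
      (𝓝 (f x)) := by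
    filter_upwards [hT.toMeasurePreserving.quasiMeasurePreserving.ae h] with x hx
    have hmono : Monotone fun n => birkhoffMax T f n (T x) :=
      monotone_nat_of_le_succ fun n => birkhoffMax_mono_succ T f n (T x)
    have htop := tendsto_atTop_atTop_of_monotone' hmono hx
    refine tendsto_const_nhds.congr' ?_
    filter_upwards [htop.eventually_ge_atTop (-f x)] with n hn
    rw [max_eq_right]
    linarith
  have hconv : Tendsto (fun n => ∫ x, max (-birkhoffMax T f n (T x)) (f x) ∂μ) atTop
      (𝓝 (∫ x, f x ∂μ)) := by
    refine tendsto_integral_of_dominated_convergence (fun x => |f x|) (fun n => ?_) hf.abs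
      (fun n => ?_) hlim
    · exact (((measurable_birkhoffMax hT.measurable hfm n).comp hT.measurable).neg.max
        hfm).aestronglyMeasurable
    · refine Eventually.of_forall fun x => ?_
      have h0 := birkhoffMax_nonneg T f n (T x)
      rw [Real.norm_eq_abs, abs_le]
      refine ⟨(neg_abs_le (f x)).trans (le_max_right _ _), max_le ?_ (le_abs_self _)⟩
      linarith [abs_nonneg (f x)]
  refine absurd (ge_of_tendsto' hconv fun n => ?_) (not_le.2 hneg)
  have hi := integrable_birkhoffMax hT.toMeasurePreserving hf
  have hiT : Integrable (fun x => birkhoffMax T f n (T x)) μ :=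
    hT.toMeasurePreserving.integrable_comp_of_integrable (hi n)
  have heq : ∀ x, max (-birkhoffMax T f n (T x)) (f x)
      = birkhoffMax T f (n + 1) x - birkhoffMax T f n (T x) := fun x => by
    simp only [birkhoffMax]
    rw [← max_sub_sub_right]
    ring_nf
  simp_rw [heq]
  have hTn : ∫ x, birkhoffMax T f n (T x) ∂μ = ∫ x, birkhoffMax T f n x ∂μ := by
    have h1 := integral_map (μ := μ) hT.measurable.aemeasurable
      (f := birkhoffMax T f n)
      (measurable_birkhoffMax hT.measurable hfm n).aestronglyMeasurable
    rw [← h1, hT.map_eq]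
  rw [integral_sub (hi (n + 1)) hiT, hTn, sub_nonneg]
  exact integral_mono (hi n) (hi (n + 1)) fun x => birkhoffMax_mono_succ T f n x

/-- Upper half of Birkhoff's ergodic theorem. -/
theorem ae_birkhoffSum_le [IsProbabilityMeasure μ] {T : α → α} (hT : Ergodic T μ)
    {f : α → ℝ} (hfm : Measurable f) (hf : Integrable f μ) {c : ℝ} (hc : ∫ x, f x ∂μ < c) :
    ∀ᵐ x ∂μ, ∃ A, ∀ n : ℕ, birkhoffSum T f n x ≤ c * n + A := by
  have h := ae_bddAbove_birkhoffMax hT (hfm.sub_const c) (hf.sub (integrable_const c))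
    (by rw [integral_sub hf (integrable_const c)]; simp; linarith)
  filter_upwards [h] with x ⟨A, hA⟩
  refine ⟨A, fun n => ?_⟩
  have h1 := (birkhoffSum_le_birkhoffMax T _ n x).trans (hA ⟨n, rfl⟩)
  simp only [birkhoffSum, Finset.sum_sub_distrib, Finset.sum_const, Finset.card_range,
    nsmul_eq_mul] at h1 ⊢
  linarith

/-- Birkhoff's pointwise ergodic theorem for an ergodic map of a probability space. -/
theorem ae_tendsto_birkhoffSum_div [IsProbabilityMeasure μ] {T : α → α} (hT : Ergodic T μ)
    {f : α → ℝ} (hfm : Measurable f) (hf : Integrable f μ) :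
    ∀ᵐ x ∂μ, Tendsto (fun n : ℕ => birkhoffSum T f n x / n) atTop (𝓝 (∫ x, f x ∂μ)) := by
  have key : ∀ (f : α → ℝ), Measurable f → Integrable f μ → ∀ᵐ x ∂μ, ∀ k : ℕ, ∃ A, ∀ n : ℕ,
      birkhoffSum T f n x ≤ (∫ x, f x ∂μ + 1 / (k + 1)) * n + A := fun f hfm hf =>
    ae_all_iff.2 fun k => ae_birkhoffSum_le hT hfm hf (lt_add_of_pos_right _ (by positivity))
  have lim : ∀ A : ℝ, Tendsto (fun n : ℕ => A / (n : ℝ)) atTop (𝓝 0) := fun A =>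
    tendsto_const_nhds.div_atTop tendsto_natCast_atTop_atTop
  filter_upwards [key f hfm hf, key (fun x => -f x) hfm.neg hf.neg] with x h1 h2
  rw [tendsto_order]
  constructor
  · intro a ha
    obtain ⟨k, hk⟩ := exists_nat_one_div_lt (sub_pos.2 ha)
    obtain ⟨A, hA⟩ := h2 k
    filter_upwards [(lim A).eventually (gt_mem_nhds (sub_pos.2 hk)), eventually_gt_atTop 0]
      with n hn hn0
    have hn0' : (0 : ℝ) < n := by exact_mod_cast hn0
    have h3 := hA n
    rw [integral_neg] at h3
    simp only [birkhoffSum, Finset.sum_neg_distrib] at h3 ⊢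
    rw [div_lt_iff₀ hn0'] at hn
    rw [lt_div_iff₀ hn0']
    nlinarith
  · intro a ha
    obtain ⟨k, hk⟩ := exists_nat_one_div_lt (sub_pos.2 ha)
    obtain ⟨A, hA⟩ := h1 k
    filter_upwards [(lim A).eventually (gt_mem_nhds (sub_pos.2 hk)), eventually_gt_atTop 0]
      with n hn hn0
    have hn0' : (0 : ℝ) < n := by exact_mod_cast hn0
    have h3 := hA n
    rw [div_lt_iff₀ hn0'] at hn
    rw [div_lt_iff₀ hn0']
    nlinarith

end Birkhoff

/-! ### Exchangeability defect of two independent copies. -/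

section Coupling

variable {𝓧 : Type*} [MeasurableSpace 𝓧]

/-- Integrate the hypothesis against `L ⊗ L'`. This carries a defect through a block with no
contraction, through an incomplete first block, and through an initial measure. -/
theorem lintegral_mul_le_of_forall {L L' : Measure 𝓧} [SFinite L] [SFinite L'] {u v : 𝓧 → ℝ≥0∞}
    (hu : Measurable u) (hv : Measurable v) {R B : ℝ≥0∞}
    (h : ∀ z z', u z * v z' ≤ v z * u z' + R * (u z * v z') + B) :
    (∫⁻ z, u z ∂L) * ∫⁻ z, v z ∂L' ≤ (∫⁻ z, v z ∂L) * (∫⁻ z, u z ∂L')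
      + R * ((∫⁻ z, u z ∂L) * ∫⁻ z, v z ∂L') + B * (L Set.univ * L' Set.univ) := by
  have huv : Measurable fun p : 𝓧 × 𝓧 => u p.1 * v p.2 :=
    (hu.comp measurable_fst).mul (hv.comp measurable_snd)
  have hvu : Measurable fun p : 𝓧 × 𝓧 => v p.1 * u p.2 :=
    (hv.comp measurable_fst).mul (hu.comp measurable_snd)
  have := lintegral_mono (μ := L.prod L') fun p : 𝓧 × 𝓧 => h p.1 p.2
  rw [lintegral_add_right _ measurable_const, lintegral_add_right _ (huv.const_mul R),
    lintegral_const_mul _ huv, lintegral_const, lintegral_prod_mul hu.aemeasurable hv.aemeasurable,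
    lintegral_prod_mul hv.aemeasurable hu.aemeasurable, ← Set.univ_prod_univ,
    Measure.prod_prod] at this
  exact this

/-- One coupling step. The measures `L`, `L'` dominate multiples of the same probability measure
`lam` and are comparable to them on `C`; a defect `R₁` of exchangeability on `C × C` is reduced by
the factor `ρ`. -/
theorem lintegral_mul_le_of_doeblin {L L' lam : Measure 𝓧} [IsFiniteMeasure L] [IsFiniteMeasure L']
    [IsFiniteMeasure lam] {C : Set 𝓧} (hC : MeasurableSet C) {c c' τ ρ : ℝ≥0}
    (hρ : ρ + τ ^ 2 = 1) (hlow : c • lam ≤ L) (hlow' : c' • lam ≤ L')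
    (hup : τ • L.restrict C ≤ c • lam) (hup' : τ • L'.restrict C ≤ c' • lam)
    {u v : 𝓧 → ℝ≥0∞} (hu : Measurable u) (hv : Measurable v) {R R₁ R₂ B : ℝ≥0∞}
    (hR₁ : ρ * R₁ ≤ R) (hR₂ : R₂ ≤ R)
    (hin : ∀ z ∈ C, ∀ z' ∈ C, u z * v z' ≤ v z * u z' + R₁ * (u z * v z') + B)
    (hout : ∀ z z', ¬ (z ∈ C ∧ z' ∈ C) → u z * v z' ≤ v z * u z' + R₂ * (u z * v z') + B) :
    (∫⁻ z, u z ∂L) * ∫⁻ z, v z ∂L' ≤ (∫⁻ z, v z ∂L) * (∫⁻ z, u z ∂L')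
      + R * ((∫⁻ z, u z ∂L) * ∫⁻ z, v z ∂L') + B * (L Set.univ * L' Set.univ) := by
  have huv : Measurable fun p : 𝓧 × 𝓧 => u p.1 * v p.2 :=
    (hu.comp measurable_fst).mul (hv.comp measurable_snd)
  have hvu : Measurable fun p : 𝓧 × 𝓧 => v p.1 * u p.2 :=
    (hv.comp measurable_fst).mul (hu.comp measurable_snd)
  set μ := L.prod L' with hμ
  set ν := (c • lam).prod (c' • lam) with hν
  set E : Set (𝓧 × 𝓧) := C ×ˢ C with hE
  have hEm : MeasurableSet E := hC.prod hC
  have hνμ : ν ≤ μ := Measure.prod_mono hlow hlow'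
  have hμν : (τ ^ 2) • μ.restrict E ≤ ν := by
    rw [hμ, hE, ← Measure.prod_restrict, pow_two, mul_smul]
    refine le_trans (le_of_eq ?_) (Measure.prod_mono hup hup')
    change (τ : ℝ≥0∞) • (τ : ℝ≥0∞) • _
      = ((τ : ℝ≥0∞) • L.restrict C).prod ((τ : ℝ≥0∞) • L'.restrict C)
    rw [Measure.prod_smul_left, Measure.prod_smul_right]
  have hsub : μ - ν + ν = μ := Measure.sub_add_cancel_of_le hνμ
  -- `ν` is a product of multiples of the same measure, hence invariant under exchange: only `μ - ν`
  -- can carry a defect.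
  have hsymm : ∫⁻ p, u p.1 * v p.2 ∂ν = ∫⁻ p, v p.1 * u p.2 ∂ν := by
    rw [lintegral_prod_mul hu.aemeasurable hv.aemeasurable,
      lintegral_prod_mul hv.aemeasurable hu.aemeasurable]
    change (∫⁻ z, u z ∂((c : ℝ≥0∞) • lam)) * (∫⁻ z, v z ∂((c' : ℝ≥0∞) • lam))
      = (∫⁻ z, v z ∂((c : ℝ≥0∞) • lam)) * (∫⁻ z, u z ∂((c' : ℝ≥0∞) • lam))
    simp only [lintegral_smul_measure, smul_eq_mul]
    ring
  have hle : μ - ν ≤ μ := Measure.sub_le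
  -- On `C × C` the symmetric part has at least the fraction `τ²` of the mass of `μ`, so at most `ρ
  -- = 1 - τ²` remains.
  have hinE : (μ - ν).restrict E ≤ (ρ : ℝ≥0∞) • μ.restrict E := by
    refine Measure.le_iff.2 fun A hA => ?_
    have h1 : (μ - ν) (A ∩ E) + ν (A ∩ E) = μ (A ∩ E) := by
      rw [← Measure.add_apply, hsub]
    have h2 : (τ : ℝ≥0∞) ^ 2 * μ (A ∩ E) ≤ ν (A ∩ E) := by
      have := hμν (A ∩ E)
      change ((τ ^ 2 : ℝ≥0) : ℝ≥0∞) * (μ.restrict E) (A ∩ E) ≤ _ at this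
      rwa [Measure.restrict_apply (hA.inter hEm), Set.inter_assoc, Set.inter_self,
        ENNReal.coe_pow] at this
    have h3 : (ρ : ℝ≥0∞) + (τ : ℝ≥0∞) ^ 2 = 1 := by exact_mod_cast hρ
    have hfin : (τ : ℝ≥0∞) ^ 2 * μ (A ∩ E) ≠ ∞ :=
      ENNReal.mul_ne_top (by finiteness) (measure_ne_top _ _)
    rw [Measure.restrict_apply hA, Measure.smul_apply, Measure.restrict_apply hA, smul_eq_mul]
    refine (ENNReal.add_le_add_iff_right hfin).1 ?_
    rw [← add_mul, h3, one_mul, ← h1]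
    gcongr
    rw [h1]
    exact h2
  have hdef : ∫⁻ p, u p.1 * v p.2 ∂(μ - ν) ≤ ∫⁻ p, v p.1 * u p.2 ∂(μ - ν)
      + R * (∫⁻ p, u p.1 * v p.2 ∂μ) + B * μ Set.univ := by
    have e1 : ∫⁻ p in E, u p.1 * v p.2 ∂(μ - ν) ≤ ∫⁻ p in E, v p.1 * u p.2 ∂(μ - ν)
        + R * (∫⁻ p in E, u p.1 * v p.2 ∂μ) + B * (μ - ν) E := by
      have := setLIntegral_mono' (μ := μ - ν) hEm fun p (hp : p ∈ E) => hin p.1 hp.1 p.2 hp.2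
      refine this.trans ?_
      rw [lintegral_add_right _ measurable_const, lintegral_add_right _ (huv.const_mul R₁),
        lintegral_const_mul _ huv, setLIntegral_const]
      refine add_le_add (add_le_add le_rfl ?_) le_rfl
      calc R₁ * ∫⁻ p in E, u p.1 * v p.2 ∂(μ - ν)
          ≤ R₁ * ∫⁻ p, u p.1 * v p.2 ∂((ρ : ℝ≥0∞) • μ.restrict E) := by
            gcongr
        _ = (ρ * R₁) * ∫⁻ p in E, u p.1 * v p.2 ∂μ := by
            rw [lintegral_smul_measure, smul_eq_mul]; ring
        _ ≤ _ := by gcongr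
    have e2 : ∫⁻ p in Eᶜ, u p.1 * v p.2 ∂(μ - ν) ≤ ∫⁻ p in Eᶜ, v p.1 * u p.2 ∂(μ - ν)
        + R * (∫⁻ p in Eᶜ, u p.1 * v p.2 ∂μ) + B * (μ - ν) Eᶜ := by
      have := setLIntegral_mono' (μ := μ - ν) hEm.compl
        fun p (hp : p ∈ Eᶜ) => hout p.1 p.2 hp
      refine this.trans ?_
      rw [lintegral_add_right _ measurable_const, lintegral_add_right _ (huv.const_mul R₂),
        lintegral_const_mul _ huv, setLIntegral_const]
      gcongr
    rw [← lintegral_add_compl (fun p : 𝓧 × 𝓧 => u p.1 * v p.2) hEm,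
      ← lintegral_add_compl (fun p : 𝓧 × 𝓧 => v p.1 * u p.2) hEm,
      ← lintegral_add_compl (μ := μ) (fun p : 𝓧 × 𝓧 => u p.1 * v p.2) hEm]
    refine (add_le_add e1 e2).trans ?_
    have hm : B * (μ - ν) E + B * (μ - ν) Eᶜ ≤ B * μ Set.univ := by
      rw [← mul_add, measure_add_measure_compl hEm]
      gcongr
    refine le_trans (le_of_eq ?_) (add_le_add_right hm _)
    ring
  have h1 : ∫⁻ p, u p.1 * v p.2 ∂μ ≤ ∫⁻ p, v p.1 * u p.2 ∂μ
      + R * (∫⁻ p, u p.1 * v p.2 ∂μ) + B * μ Set.univ := by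
    calc ∫⁻ p, u p.1 * v p.2 ∂μ
        = ∫⁻ p, u p.1 * v p.2 ∂(μ - ν) + ∫⁻ p, u p.1 * v p.2 ∂ν := by
          rw [← lintegral_add_measure, hsub]
      _ ≤ (∫⁻ p, v p.1 * u p.2 ∂(μ - ν) + R * (∫⁻ p, u p.1 * v p.2 ∂μ) + B * μ Set.univ)
          + ∫⁻ p, v p.1 * u p.2 ∂ν := by rw [hsymm]; gcongr
      _ = (∫⁻ p, v p.1 * u p.2 ∂(μ - ν) + ∫⁻ p, v p.1 * u p.2 ∂ν)
          + R * (∫⁻ p, u p.1 * v p.2 ∂μ) + B * μ Set.univ := by ring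
      _ = _ := by rw [← lintegral_add_measure, hsub]
  rwa [lintegral_prod_mul hu.aemeasurable hv.aemeasurable,
    lintegral_prod_mul hv.aemeasurable hu.aemeasurable, ← Set.univ_prod_univ,
    Measure.prod_prod] at h1

/-- Backward iteration of a sequence of kernels: `L (n-1) ⋯ L 0 f`. -/
def iterKernel (L : ℕ → Kernel 𝓧 𝓧) (f : 𝓧 → ℝ≥0∞) : ℕ → 𝓧 → ℝ≥0∞
  | 0 => f
  | n + 1 => fun x => ∫⁻ z, iterKernel L f n z ∂(L n x)

theorem measurable_iterKernel (L : ℕ → Kernel 𝓧 𝓧) {f : 𝓧 → ℝ≥0∞} (hf : Measurable f) (n : ℕ) :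
    Measurable (iterKernel L f n) := by
  induction n with
  | zero => exact hf
  | succ n ih => exact ih.lintegral_kernel

theorem iterKernel_le {L : ℕ → Kernel 𝓧 𝓧} {s : ℕ → ℝ≥0} (hs : ∀ n x, L n x Set.univ ≤ s n)
    {f : 𝓧 → ℝ≥0∞} {F : ℝ≥0∞} (hf : ∀ x, f x ≤ F) (n : ℕ) (x : 𝓧) :
    iterKernel L f n x ≤ F * ∏ k ∈ Finset.range n, (s k : ℝ≥0∞) := by
  induction n generalizing x with
  | zero => simpa [iterKernel] using hf x
  | succ n ih =>
    refine (lintegral_mono ih).trans ?_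
    rw [lintegral_const, Finset.prod_range_succ, ← mul_assoc]
    gcongr
    exact hs n x

open Classical in
/-- Number of indices `k` with `k + 1 < n` such that `κ k` and `κ (k + 1)`. -/
def pairCount (κ : ℕ → Prop) : ℕ → ℕ
  | 0 => 0
  | n + 1 => pairCount κ n + if 0 < n ∧ κ (n - 1) ∧ κ n then 1 else 0

-- A good block is the first one, or follows a good block (a pair), or follows a bad block; so the
-- number of good blocks is at most pairs plus bad blocks plus one. The induction spends the extra
-- one only when the last block is good.
open Classical in
theorem two_mul_card_le_pairCount (κ : ℕ → Prop) (n : ℕ) :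
    2 * ((Finset.range n).filter κ).card ≤ pairCount κ n + n + 1 := by
  suffices h : 2 * ((Finset.range n).filter κ).card ≤
      pairCount κ n + n + if 0 < n ∧ κ (n - 1) then 1 else 0 from
    h.trans (by split_ifs <;> omega)
  induction n with
  | zero => simp
  | succ n ih =>
    rw [Finset.range_add_one, Finset.filter_insert, pairCount]
    by_cases hn : 0 < n <;> by_cases h1 : κ (n - 1) <;> by_cases h2 : κ n <;>
      simp [hn, h1, h2] at ih ⊢ <;> omega

/-- Approximate exchangeability of the two coordinates after `n` blocks, when the blocks in `κ` are
local Doeblin with constant `τ` on `C` and contract by `η` outside `C`. -/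
theorem iterKernel_mul_le {L : ℕ → Kernel 𝓧 𝓧} {s : ℕ → ℝ≥0}
    (hs : ∀ n x, L n x Set.univ ≤ s n) {κ : ℕ → Prop} {C : Set 𝓧} (hC : MeasurableSet C)
    {τ ρ η : ℝ≥0} (hρ : ρ + τ ^ 2 = 1)
    (hdoeblin : ∀ k, κ k → ∃ (lam : Measure 𝓧) (c : 𝓧 → ℝ≥0), IsFiniteMeasure lam ∧
      ∀ x ∈ C, c x • lam ≤ L k x ∧ τ • (L k x).restrict C ≤ c x • lam)
    (hη : ∀ k, κ k → ∀ x ∉ C, L k x Set.univ ≤ η * s k)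
    {f h : 𝓧 → ℝ≥0∞} (hf : Measurable f) (hh : Measurable h) {F H : ℝ≥0∞}
    (hF : ∀ x, f x ≤ F) (hH : ∀ x, h x ≤ H) (b n : ℕ) (x x' : 𝓧) :
    iterKernel L f n x * iterKernel L h n x' ≤ iterKernel L h n x * iterKernel L f n x'
      + (ρ : ℝ≥0∞) ^ (pairCount κ n - 2 * b) * (iterKernel L f n x * iterKernel L h n x')
      + (η : ℝ≥0∞) ^ b * (F * H * ∏ k ∈ Finset.range n, (s k : ℝ≥0∞) ^ 2) := by
  classical
  have hρ1 : (ρ : ℝ≥0∞) ≤ 1 := by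
    have : ρ ≤ 1 := hρ ▸ le_self_add
    exact_mod_cast this
  have hpow : ∀ {i j : ℕ}, i ≤ j → (ρ : ℝ≥0∞) ^ j ≤ (ρ : ℝ≥0∞) ^ i :=
    fun hij => pow_le_pow_right_of_le_one' hρ1 hij
  have hfin : ∀ n x, IsFiniteMeasure (L n x) := fun n x =>
    ⟨(hs n x).trans_lt ENNReal.coe_lt_top⟩
  -- The induction needs one more exponent when the pair starts outside `C × C` at a good block: the
  -- visit about to be charged to the budget also spoils the pair formed with the next block of the
  -- recursion.
  suffices key : iterKernel L f n x * iterKernel L h n x' ≤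
      iterKernel L h n x * iterKernel L f n x'
      + (ρ : ℝ≥0∞) ^ (pairCount κ n
          + (if 0 < n ∧ κ (n - 1) ∧ ¬ (x ∈ C ∧ x' ∈ C) then 1 else 0) - 2 * b)
        * (iterKernel L f n x * iterKernel L h n x')
      + (η : ℝ≥0∞) ^ b * (F * H * ∏ k ∈ Finset.range n, (s k : ℝ≥0∞) ^ 2) by
    exact key.trans (add_le_add (add_le_add le_rfl (mul_le_mul' (hpow (by omega)) le_rfl)) le_rfl)
  induction n generalizing b x x' with
  | zero =>
    simp only [lt_irrefl, false_and, if_false, pairCount, zero_add, zero_tsub, pow_zero, one_mul]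
    exact le_add_self.trans le_self_add
  | succ n ih =>
    have hmass : L n x Set.univ * L n x' Set.univ ≤ (s n : ℝ≥0∞) ^ 2 := by
      rw [pow_two]; exact mul_le_mul' (hs n x) (hs n x')
    have hfm := measurable_iterKernel L hf n
    have hhm := measurable_iterKernel L hh n
    by_cases hκ : κ n
    · obtain ⟨lam, c, hlam, hdo⟩ := hdoeblin n hκ
      by_cases hxC : x ∈ C ∧ x' ∈ C
      -- Landing in `C × C` gains a factor `ρ`. Landing outside before a good block gains nothing
      -- here, but the induction hypothesis already holds the extra exponent that the pair `(n - 1,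
      -- n)` requires.
      · have := lintegral_mul_le_of_doeblin (L := L n x) (L' := L n x') (lam := lam) hC hρ
          (hdo x hxC.1).1 (hdo x' hxC.2).1 (hdo x hxC.1).2 (hdo x' hxC.2).2 hfm hhm
          (R := (ρ : ℝ≥0∞) ^ (pairCount κ (n + 1) - 2 * b))
          (R₁ := (ρ : ℝ≥0∞) ^ (pairCount κ n - 2 * b))
          (R₂ := (ρ : ℝ≥0∞) ^ (pairCount κ n
            + (if 0 < n ∧ κ (n - 1) then 1 else 0) - 2 * b))
          (B := (η : ℝ≥0∞) ^ b * (F * H * ∏ k ∈ Finset.range n, (s k : ℝ≥0∞) ^ 2))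
          (by
            rw [← pow_succ']
            refine hpow ?_
            rw [pairCount]
            split_ifs <;> omega)
          (hpow (by rw [pairCount]; simp only [hκ, and_true]; omega))
          (fun z hz z' hz' => by
            have := ih b z z'
            rwa [if_neg (by tauto), add_zero] at this)
          (fun z z' hz => by
            have := ih b z z'
            simpa only [hz, not_false_iff, and_true] using this)
        rw [if_neg (by tauto), add_zero]
        refine this.trans (add_le_add le_rfl ?_)
        rw [Finset.prod_range_succ, mul_assoc, mul_assoc (F * H)]
        gcongr
      · rw [if_pos ⟨n.succ_pos, hκ, hxC⟩]
        cases b with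
        -- The budget is exhausted, and the crude bound by suprema suffices.
        | zero =>
          refine le_trans ?_ le_add_self
          rw [pow_zero, one_mul, Finset.prod_pow, pow_two, mul_mul_mul_comm]
          exact mul_le_mul' (iterKernel_le hs hF _ x) (iterKernel_le hs hH _ x')
        -- One unit of budget is spent for a factor `η`. The two exponents it frees pay for the pair
        -- `(n - 1, n)` and for the extra exponent.
        | succ b =>
          have := lintegral_mul_le_of_forall (L := L n x) (L' := L n x') hfm hhm
            (R := (ρ : ℝ≥0∞) ^ (pairCount κ (n + 1) + 1 - 2 * (b + 1)))
            (B := (η : ℝ≥0∞) ^ b * (F * H * ∏ k ∈ Finset.range n, (s k : ℝ≥0∞) ^ 2))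
            (fun z z' => (ih b z z').trans (by
              refine add_le_add (add_le_add le_rfl (mul_le_mul' (hpow ?_) le_rfl)) le_rfl
              rw [pairCount]
              split_ifs <;> omega))
          refine this.trans (add_le_add le_rfl ?_)
          have hm : L n x Set.univ * L n x' Set.univ ≤ η * (s n : ℝ≥0∞) ^ 2 := by
            rcases not_and_or.1 hxC with hx | hx
            · rw [pow_two, ← mul_assoc]
              exact mul_le_mul' (hη n hκ x hx) (hs n x')
            · rw [pow_two, mul_left_comm]
              exact mul_le_mul' (hs n x) (hη n hκ x' hx)
          refine (mul_le_mul_right hm _).trans (le_of_eq ?_)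
          rw [Finset.prod_range_succ, pow_succ]
          ring
    · have := lintegral_mul_le_of_forall (L := L n x) (L' := L n x') hfm hhm
        (R := (ρ : ℝ≥0∞) ^ (pairCount κ (n + 1) - 2 * b))
        (B := (η : ℝ≥0∞) ^ b * (F * H * ∏ k ∈ Finset.range n, (s k : ℝ≥0∞) ^ 2))
        (fun z z' => (ih b z z').trans (by
          refine add_le_add (add_le_add le_rfl (mul_le_mul' (hpow ?_) le_rfl)) le_rfl
          rw [pairCount]
          split_ifs <;> first | omega | tauto))
      rw [if_neg (by simp [hκ]), add_zero]
      refine this.trans (add_le_add le_rfl ?_)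
      rw [Finset.prod_range_succ, mul_assoc, mul_assoc (F * H)]
      gcongr

end Coupling

/-! ### Unnormalized kernels and window likelihoods. -/

section Window

variable {𝓧 𝓨 : Type*} [MeasurableSpace 𝓧]

theorem blockOp_mono (Q : Kernel 𝓧 𝓧) (g : 𝓧 → 𝓨 → ℝ≥0) (t : ℕ) (y : Fin t → 𝓨)
    {f h : 𝓧 → ℝ≥0∞} (hfh : f ≤ h) (x : 𝓧) : blockOp Q g t y f x ≤ blockOp Q g t y h x := by
  induction t generalizing x with
  | zero => exact hfh x
  | succ t ih => exact mul_le_mul_right (lintegral_mono fun x' => ih _ x') _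

theorem likelihoodFrom_eq_blockOp (Q : Kernel 𝓧 𝓧) [IsMarkovKernel Q] (g : 𝓧 → 𝓨 → ℝ≥0)
    (t : ℕ) (y : Fin t → 𝓨) (x : 𝓧) : likelihoodFrom Q g t y x = blockOp Q g t y 1 x := by
  induction t generalizing x with
  | zero => rfl
  | succ t ih =>
    cases t with
    | zero => simp [likelihoodFrom, blockOp]
    | succ t =>
      simp only [likelihoodFrom, blockOp.eq_def Q g (t + 1 + 1)]
      congr 1
      exact lintegral_congr fun x' => ih _ x'

theorem measurable_blockOp_prod [MeasurableSpace 𝓨] (Q : Kernel 𝓧 𝓧) [IsMarkovKernel Q]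
    {g : 𝓧 → 𝓨 → ℝ≥0} (hg : Measurable (Function.uncurry g)) (t : ℕ) {f : 𝓧 → ℝ≥0∞}
    (hf : Measurable f) :
    Measurable fun p : (Fin t → 𝓨) × 𝓧 => blockOp Q g t p.1 f p.2 := by
  induction t with
  | zero => exact hf.comp measurable_snd
  | succ t ih =>
    have htail : Measurable fun y : Fin (t + 1) → 𝓨 => Fin.tail y :=
      measurable_pi_lambda _ fun i => measurable_pi_apply _
    refine Measurable.mul ?_ ?_
    · exact (hg.comp (measurable_snd.prodMk
        ((measurable_pi_apply 0).comp measurable_fst))).coe_nnreal_ennreal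
    · have h1 : Measurable fun q : ((Fin (t + 1) → 𝓨) × 𝓧) × 𝓧 =>
          blockOp Q g t (Fin.tail q.1.1) f q.2 :=
        ih.comp ((htail.comp (measurable_fst.comp measurable_fst)).prodMk measurable_snd)
      exact h1.lintegral_kernel_prod_right' (κ := Q.comap Prod.snd measurable_snd)

theorem measurable_blockOp [MeasurableSpace 𝓨] (Q : Kernel 𝓧 𝓧) [IsMarkovKernel Q]
    {g : 𝓧 → 𝓨 → ℝ≥0} (hg : Measurable (Function.uncurry g)) (t : ℕ) {f : 𝓧 → ℝ≥0∞}
    (hf : Measurable f) (y : Fin t → 𝓨) : Measurable (blockOp Q g t y f) :=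
  (measurable_blockOp_prod Q hg t hf).comp (measurable_const.prodMk measurable_id)

/-- The unnormalized kernel `L⟨y_0, …, y_{t-1}⟩` as a `Kernel`. -/
def obsKernel (Q : Kernel 𝓧 𝓧) [IsMarkovKernel Q] (g : 𝓧 → 𝓨 → ℝ≥0) :
    (t : ℕ) → (Fin t → 𝓨) → Kernel 𝓧 𝓧
  | 0, _ => Kernel.id
  | t + 1, y => obsKernel Q g t (Fin.tail y) ∘ₖ
      Q.withDensity fun x _ => (g x (y 0) : ℝ≥0∞)

theorem lintegral_obsKernel [MeasurableSpace 𝓨] (Q : Kernel 𝓧 𝓧) [IsMarkovKernel Q]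
    {g : 𝓧 → 𝓨 → ℝ≥0} (hg : Measurable (Function.uncurry g)) (t : ℕ) (y : Fin t → 𝓨)
    {f : 𝓧 → ℝ≥0∞} (hf : Measurable f) (x : 𝓧) :
    ∫⁻ z, f z ∂(obsKernel Q g t y x) = blockOp Q g t y f x := by
  induction t generalizing x with
  | zero => simp [obsKernel, blockOp, Kernel.id_apply, lintegral_dirac' _ hf]
  | succ t ih =>
    have hg0 : Measurable fun x => g x (y 0) := hg.comp (measurable_id.prodMk measurable_const)
    rw [obsKernel, Kernel.lintegral_comp _ _ _ hf]
    simp_rw [ih]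
    rw [Kernel.lintegral_withDensity _ (by fun_prop) _ (measurable_blockOp Q hg t hf _),
      lintegral_const_mul _ (measurable_blockOp Q hg t hf _)]
    rfl

theorem obsKernel_apply [MeasurableSpace 𝓨] (Q : Kernel 𝓧 𝓧) [IsMarkovKernel Q]
    {g : 𝓧 → 𝓨 → ℝ≥0} (hg : Measurable (Function.uncurry g)) {t : ℕ} (y : Fin t → 𝓨) (x : 𝓧)
    {A : Set 𝓧} (hA : MeasurableSet A) : obsKernel Q g t y x A = blockKernel Q g y x A := by
  rw [blockKernel, ← lintegral_obsKernel Q hg t y (measurable_one.indicator hA),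
    lintegral_indicator_one hA]

theorem obsKernel_univ [MeasurableSpace 𝓨] (Q : Kernel 𝓧 𝓧) [IsMarkovKernel Q]
    {g : 𝓧 → 𝓨 → ℝ≥0} (hg : Measurable (Function.uncurry g)) {t : ℕ} (y : Fin t → 𝓨) (x : 𝓧) :
    obsKernel Q g t y x Set.univ = blockOp Q g t y 1 x := by
  rw [obsKernel_apply Q hg y x MeasurableSet.univ, blockKernel, Set.indicator_univ]

theorem tail_block (y : ℤ → 𝓨) (i : ℤ) (t : ℕ) :
    Fin.tail (block y i (t + 1)) = block y (i + 1) t := by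
  funext k
  simp only [Fin.tail, block, Fin.val_succ]
  congr 1
  push_cast
  ring

theorem block_zero (y : ℤ → 𝓨) (i : ℤ) (t : ℕ) : block y i (t + 1) 0 = y i := by
  simp [block]

theorem blockOp_block_succ (Q : Kernel 𝓧 𝓧) (g : 𝓧 → 𝓨 → ℝ≥0) (y : ℤ → 𝓨) (i : ℤ) (t : ℕ)
    (f : 𝓧 → ℝ≥0∞) (x : 𝓧) : blockOp Q g (t + 1) (block y i (t + 1)) f x
      = g x (y i) * ∫⁻ x', blockOp Q g t (block y (i + 1) t) f x' ∂(Q x) := by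
  rw [blockOp, tail_block, block_zero]

theorem blockOp_block_add (Q : Kernel 𝓧 𝓧) (g : 𝓧 → 𝓨 → ℝ≥0) (y : ℤ → 𝓨) (i : ℤ) (s t : ℕ)
    (f : 𝓧 → ℝ≥0∞) (x : 𝓧) : blockOp Q g (s + t) (block y i (s + t)) f x
      = blockOp Q g s (block y i s) (blockOp Q g t (block y (i + s) t) f) x := by
  induction s generalizing i x with
  | zero =>
    rw [Nat.zero_add]
    simp [blockOp]
  | succ s ih =>
    rw [show s + 1 + t = s + t + 1 by ring, blockOp_block_succ, blockOp_block_succ]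
    congr 1
    refine lintegral_congr fun x' => ?_
    rw [ih, show i + 1 + (s : ℤ) = i + ((s + 1 : ℕ) : ℤ) by push_cast; ring]

/-- Likelihood of `(y_i, …, y_{i+t-1})` for the hidden chain started at `x` at time `i`. -/
def windowLik (Q : Kernel 𝓧 𝓧) (g : 𝓧 → 𝓨 → ℝ≥0) (y : ℤ → 𝓨) (i : ℤ) (t : ℕ) (x : 𝓧) : ℝ≥0∞ :=
  blockOp Q g t (block y i t) 1 x

theorem likelihood_block (Q : Kernel 𝓧 𝓧) [IsMarkovKernel Q] (g : 𝓧 → 𝓨 → ℝ≥0) (χ : Measure 𝓧)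
    (y : ℤ → 𝓨) (i : ℤ) (t : ℕ) :
    likelihood Q g χ (block y i t) = ∫⁻ x, windowLik Q g y i t x ∂χ := by
  simp_rw [likelihood, likelihoodFrom_eq_blockOp, windowLik]

theorem measurable_windowLik [MeasurableSpace 𝓨] (Q : Kernel 𝓧 𝓧) [IsMarkovKernel Q]
    {g : 𝓧 → 𝓨 → ℝ≥0} (hg : Measurable (Function.uncurry g)) (y : ℤ → 𝓨) (i : ℤ) (t : ℕ) :
    Measurable (windowLik Q g y i t) :=
  measurable_blockOp Q hg t measurable_one _

theorem windowLik_zero (Q : Kernel 𝓧 𝓧) (g : 𝓧 → 𝓨 → ℝ≥0) (y : ℤ → 𝓨) (i : ℤ) (x : 𝓧) :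
    windowLik Q g y i 0 x = 1 := rfl

theorem windowLik_add (Q : Kernel 𝓧 𝓧) (g : 𝓧 → 𝓨 → ℝ≥0) (y : ℤ → 𝓨) (i : ℤ) (s t : ℕ) (x : 𝓧) :
    windowLik Q g y i (s + t) x = blockOp Q g s (block y i s) (windowLik Q g y (i + s) t) x :=
  blockOp_block_add Q g y i s t 1 x

theorem windowLik_add' [MeasurableSpace 𝓨] (Q : Kernel 𝓧 𝓧) [IsMarkovKernel Q]
    {g : 𝓧 → 𝓨 → ℝ≥0} (hg : Measurable (Function.uncurry g)) (y : ℤ → 𝓨) (i : ℤ) (s t : ℕ)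
    (x : 𝓧) : windowLik Q g y i (s + t) x
      = ∫⁻ z, windowLik Q g y (i + s) t z ∂(obsKernel Q g s (block y i s) x) := by
  rw [windowLik_add, lintegral_obsKernel Q hg _ _ (measurable_windowLik Q hg y _ _)]

end Window

/-! ### Exponentials of window sums. -/

section Exp

/-- The exponential as a map to `ℝ≥0∞`. -/
def expE (a : ℝ) : ℝ≥0∞ := ENNReal.ofReal (Real.exp a)

theorem expE_zero : expE 0 = 1 := by simp [expE]

theorem expE_add (a b : ℝ) : expE (a + b) = expE a * expE b := by
  rw [expE, Real.exp_add, ENNReal.ofReal_mul (Real.exp_pos a).le, expE, expE]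

theorem expE_le {a b : ℝ} : expE a ≤ expE b ↔ a ≤ b := by
  rw [expE, expE, ENNReal.ofReal_le_ofReal_iff (Real.exp_pos b).le, Real.exp_le_exp]

theorem expE_pos (a : ℝ) : 0 < expE a := ENNReal.ofReal_pos.2 (Real.exp_pos a)

theorem expE_ne_top (a : ℝ) : expE a ≠ ∞ := ENNReal.ofReal_ne_top

theorem expE_nat_mul (n : ℕ) (a : ℝ) : expE (n * a) = expE a ^ n := by
  rw [expE, Real.exp_nat_mul, ENNReal.ofReal_pow (Real.exp_pos a).le, expE]

theorem expE_neg_mul (a : ℝ) : expE (-a) * expE a = 1 := by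
  rw [← expE_add, neg_add_cancel, expE_zero]

/-- The sum of `φ` over the window `i, …, i + t - 1`. -/
def windowSum (φ : ℤ → ℝ) (i : ℤ) (t : ℕ) : ℝ := ∑ k ∈ Finset.range t, φ (i + k)

theorem windowSum_add (φ : ℤ → ℝ) (i : ℤ) (s t : ℕ) :
    windowSum φ i (s + t) = windowSum φ i s + windowSum φ (i + s) t := by
  simp only [windowSum, Finset.sum_range_add, Nat.cast_add, add_assoc]

theorem windowSum_one (φ : ℤ → ℝ) (i : ℤ) : windowSum φ i 1 = φ i := by simp [windowSum]

theorem windowSum_succ (φ : ℤ → ℝ) (i : ℤ) (t : ℕ) :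
    windowSum φ i (t + 1) = φ i + windowSum φ (i + 1) t := by
  rw [add_comm t, windowSum_add, windowSum_one, Nat.cast_one]

theorem windowSum_nonneg {φ : ℤ → ℝ} (hφ : 0 ≤ φ) (i : ℤ) (t : ℕ) : 0 ≤ windowSum φ i t :=
  Finset.sum_nonneg fun _ _ => hφ _

theorem windowSum_mono {φ : ℤ → ℝ} (hφ : 0 ≤ φ) (i : ℤ) {s t : ℕ} (hst : s ≤ t) :
    windowSum φ i s ≤ windowSum φ i t := by
  obtain ⟨u, rfl⟩ := Nat.exists_eq_add_of_le hst
  rw [windowSum_add]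
  linarith [windowSum_nonneg hφ (i + s) u]

end Exp

/-! ### Upper and lower bounds on window likelihoods. -/

section Bounds

variable {𝓧 𝓨 : Type*} [MeasurableSpace 𝓧] {Q : Kernel 𝓧 𝓧} [IsMarkovKernel Q]
  {g : 𝓧 → 𝓨 → ℝ≥0} {y : ℤ → 𝓨} {φ : ℤ → ℝ}

theorem blockOp_le (hG : ∀ j x, (g x (y j) : ℝ≥0∞) ≤ expE (φ j)) {f : 𝓧 → ℝ≥0∞} {F : ℝ≥0∞}
    (hf : ∀ x, f x ≤ F) (i : ℤ) (t : ℕ) (x : 𝓧) :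
    blockOp Q g t (block y i t) f x ≤ expE (windowSum φ i t) * F := by
  induction t generalizing i x with
  | zero => simpa [blockOp, windowSum, expE_zero] using hf x
  | succ t ih =>
    rw [blockOp_block_succ, windowSum_succ, expE_add, mul_assoc]
    refine mul_le_mul' (hG i x) ?_
    refine (lintegral_mono fun x' => ih (i + 1) x').trans ?_
    simp

theorem windowLik_le (hG : ∀ j x, (g x (y j) : ℝ≥0∞) ≤ expE (φ j)) (i : ℤ) (t : ℕ) (x : 𝓧) :
    windowLik Q g y i t x ≤ expE (windowSum φ i t) := by
  simpa [windowLik] using blockOp_le (Q := Q) hG (f := 1) (F := 1) (fun _ => le_rfl) i t x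

theorem blockOp_const_mul [MeasurableSpace 𝓨] (hg : Measurable (Function.uncurry g)) (t : ℕ)
    (z : Fin t → 𝓨) {f : 𝓧 → ℝ≥0∞} (hf : Measurable f) (a : ℝ≥0∞) (x : 𝓧) :
    blockOp Q g t z (fun x => a * f x) x = a * blockOp Q g t z f x := by
  rw [← lintegral_obsKernel Q hg t z hf, ← lintegral_obsKernel Q hg t z (hf.const_mul a),
    lintegral_const_mul _ hf]

/-- Lengthening the window multiplies the likelihood by at most the suprema of `g`. -/
theorem windowLik_add_le [MeasurableSpace 𝓨] (hg : Measurable (Function.uncurry g))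
    (hG : ∀ j x, (g x (y j) : ℝ≥0∞) ≤ expE (φ j)) (i : ℤ) (s t : ℕ) (x : 𝓧) :
    windowLik Q g y i (s + t) x ≤ expE (windowSum φ (i + s) t) * windowLik Q g y i s x := by
  rw [windowLik_add, windowLik, ← blockOp_const_mul hg s _ measurable_one]
  refine blockOp_mono Q g s _ (fun z => ?_) x
  simpa using windowLik_le hG (i + s) t z

variable {r : ℕ} {D : Set 𝓧}

/-- Keep the chain in `D` at the end of every block. A block costs `φ` at its first index, which is
at most the sum of `φ` over the block. -/
theorem expE_le_windowLik_of_mem [MeasurableSpace 𝓨] (hg : Measurable (Function.uncurry g))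
    (hφ : 0 ≤ φ) (hr : 1 ≤ r) (hD : MeasurableSet D)
    (hmin : ∀ j, ∀ x ∈ D, expE (-φ j) ≤ blockKernel Q g (block y j r) x D) (i : ℤ) (b : ℕ)
    {x : 𝓧} (hx : x ∈ D) : expE (-windowSum φ i (b * r)) ≤ windowLik Q g y i (b * r) x := by
  induction b generalizing i x with
  | zero => simp [windowSum, expE_zero, windowLik_zero]
  | succ b ih =>
    rw [show (b + 1) * r = r + b * r by ring, windowLik_add]
    have h1 : blockOp Q g r (block y i r)
        (fun z => expE (-windowSum φ (i + r) (b * r)) * D.indicator 1 z) x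
        ≤ blockOp Q g r (block y i r) (windowLik Q g y (i + r) (b * r)) x := by
      refine blockOp_mono Q g r _ (fun z => ?_) x
      by_cases hz : z ∈ D
      · simpa [hz] using ih (i + r) hz
      · simp [hz]
    refine le_trans ?_ h1
    rw [blockOp_const_mul hg r _ (measurable_one.indicator hD)]
    refine le_trans ?_ (mul_le_mul_right (hmin i x hx) _)
    rw [← expE_add, expE_le, windowSum_add]
    have := windowSum_mono hφ i hr
    rw [windowSum_one] at this
    linarith

theorem expE_le_lintegral_windowLik_mul [MeasurableSpace 𝓨] (hg : Measurable (Function.uncurry g))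
    (hφ : 0 ≤ φ) (hr : 1 ≤ r) (hD : MeasurableSet D)
    (hmin : ∀ j, ∀ x ∈ D, expE (-φ j) ≤ blockKernel Q g (block y j r) x D) {χ : Measure 𝓧} {i : ℤ}
    (hχ : expE (-φ i) ≤ ∫⁻ x, blockKernel Q g (block y i r) x D ∂χ) (b : ℕ) :
    expE (-windowSum φ i ((b + 1) * r)) ≤ ∫⁻ x, windowLik Q g y i ((b + 1) * r) x ∂χ := by
  have h1 : ∀ x, expE (-windowSum φ (i + r) (b * r)) * blockKernel Q g (block y i r) x D
      ≤ windowLik Q g y i ((b + 1) * r) x := fun x => by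
    rw [show (b + 1) * r = r + b * r by ring, windowLik_add, blockKernel,
      ← blockOp_const_mul hg r _ (measurable_one.indicator hD)]
    refine blockOp_mono Q g r _ (fun z => ?_) x
    by_cases hz : z ∈ D
    · simpa [hz] using expE_le_windowLik_of_mem hg hφ hr hD hmin (i + r) b hz
    · simp [hz]
  refine le_trans ?_ (lintegral_mono h1)
  rw [lintegral_const_mul' _ _ (expE_ne_top _)]
  refine le_trans ?_ (mul_le_mul_right hχ _)
  rw [← expE_add, expE_le, add_mul, one_mul, add_comm (b * r), windowSum_add]
  have := windowSum_mono hφ i hr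
  rw [windowSum_one] at this
  linarith

/-- Lower bound of the likelihood of a window of arbitrary length. -/
theorem expE_le_lintegral_windowLik [MeasurableSpace 𝓨] (hg : Measurable (Function.uncurry g))
    (hφ : 0 ≤ φ) (hG : ∀ j x, (g x (y j) : ℝ≥0∞) ≤ expE (φ j)) (hr : 1 ≤ r) (hD : MeasurableSet D)
    (hmin : ∀ j, ∀ x ∈ D, expE (-φ j) ≤ blockKernel Q g (block y j r) x D) {χ : Measure 𝓧} {i : ℤ}
    (hχ : expE (-φ i) ≤ ∫⁻ x, blockKernel Q g (block y i r) x D ∂χ) (N : ℕ) :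
    expE (-(2 * windowSum φ i (N + r))) ≤ ∫⁻ x, windowLik Q g y i N x ∂χ := by
  -- When `r` divides `N` this takes `q = r`: at least one whole block is needed, since `χ` is only
  -- known to charge `D` after one.
  obtain ⟨q, hq⟩ : ∃ q, N + q = (N / r + 1) * r ∧ q ≤ r := by
    have h1 := Nat.div_add_mod N r
    have h2 := Nat.mod_lt N hr
    refine ⟨r - N % r, ?_, by omega⟩
    rw [add_mul, one_mul, mul_comm]
    omega
  have h1 := expE_le_lintegral_windowLik_mul hg hφ hr hD hmin hχ (N / r)
  rw [← hq.1] at h1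
  have h2 := h1.trans (lintegral_mono fun x => windowLik_add_le hg hG i N q x)
  -- Removing the `q` added observations costs at most a second window sum, hence the factor 2.
  rw [lintegral_const_mul' _ _ (expE_ne_top _)] at h2
  have h3 := mul_le_mul_right h2 (expE (-windowSum φ (i + N) q))
  rw [← mul_assoc, expE_neg_mul, one_mul, ← expE_add] at h3
  refine le_trans (expE_le.2 ?_) h3
  have e1 := windowSum_mono hφ i (Nat.add_le_add_left hq.2 N)
  have e2 := windowSum_add φ i N q
  have e3 := windowSum_nonneg hφ i N
  linarith

end Bounds

/-! ### Near-exchangeability along a regular path. -/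

section Exchange

variable {𝓧 𝓨 : Type*} [MeasurableSpace 𝓧]

/-- Blocks in `K` satisfy, for each `η > 0`, a local Doeblin condition on a set `C` outside of which
the likelihood of the block is at most `η` times its supremum. -/
def HasDoeblinBlocks (Q : Kernel 𝓧 𝓧) [IsMarkovKernel Q] (g : 𝓧 → 𝓨 → ℝ≥0) {r : ℕ}
    (K : Set (Fin r → 𝓨)) : Prop :=
  ∀ η : ℝ≥0, 0 < η → ∃ (C : Set 𝓧) (τ ρ : ℝ≥0), MeasurableSet C ∧ 0 < τ ∧ ρ + τ ^ 2 = 1 ∧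
    (∀ z ∈ K, ∃ (lam : Measure 𝓧) (c : 𝓧 → ℝ≥0), IsFiniteMeasure lam ∧ ∀ x ∈ C,
      c x • lam ≤ obsKernel Q g r z x ∧ τ • (obsKernel Q g r z x).restrict C ≤ c x • lam) ∧
    ∀ z ∈ K, ∀ x ∉ C, ∀ S : ℝ≥0∞, (∀ x', blockOp Q g r z 1 x' ≤ S) →
      blockOp Q g r z 1 x ≤ η * S

theorem hasDoeblinBlocks_of_forall_isLocalDoeblin [MeasurableSpace 𝓨] {Θ : Type*}
    {Q : Θ → Kernel 𝓧 𝓧} (hQ : ∀ θ, IsMarkovKernel (Q θ)) {g : Θ → 𝓧 → 𝓨 → ℝ≥0}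
    (hg : ∀ θ, Measurable (Function.uncurry (g θ))) {r : ℕ} {K : Set (Fin r → 𝓨)}
    (h : ∀ η : ℝ≥0, 0 < η → ∃ (C : Set 𝓧) (εm εp : (Fin r → 𝓨) → ℝ≥0),
      IsLocalDoeblin Q g r C εm εp ∧
      (∀ θ, ∀ y ∈ K,
        (⨆ x ∈ Cᶜ, likelihood (Q θ) (g θ) (Measure.dirac x) y)
            ≤ η * ⨆ x, likelihood (Q θ) (g θ) (Measure.dirac x) y ∧
        η * (⨆ x, likelihood (Q θ) (g θ) (Measure.dirac x) y) < ∞) ∧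
      0 < ⨅ y ∈ K, (εm y : ℝ≥0∞) / εp y) (θ : Θ) :
    HasDoeblinBlocks (Q θ) (g θ) K := by
  intro η hη
  obtain ⟨C, εm, εp, ⟨hC, hm, hp, lam, φ, hφ, hdo⟩, hsup, hinf⟩ := h η hη
  -- One `τ` serves all blocks in `K` because the infimum of `εm / εp` is positive; `τ < 1` makes `ρ
  -- = 1 - τ²` nonnegative.
  obtain ⟨τ, hτ0, hτ⟩ := ENNReal.lt_iff_exists_nnreal_btwn.1 (lt_min hinf one_pos)
  have hτ1 : τ < 1 := by exact_mod_cast hτ.trans_le (min_le_right _ _)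
  have hτ2 : τ ^ 2 ≤ 1 := pow_le_one' hτ1.le 2
  refine ⟨C, τ, 1 - τ ^ 2, hC, by exact_mod_cast hτ0, tsub_add_cancel_of_le hτ2, fun z hz => ?_,
    fun z hz x hx S hS => ?_⟩
  · refine ⟨lam θ z, fun x => εm z * φ θ z x, inferInstance, fun x hx => ⟨?_, ?_⟩⟩
    · refine Measure.le_iff.2 fun A hA => ?_
      change ((εm z * φ θ z x : ℝ≥0) : ℝ≥0∞) * _ ≤ _
      rw [ENNReal.coe_mul]
      refine ((hdo θ z).2 A hA x hx).1.trans ?_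
      rw [← obsKernel_apply (Q θ) (hg θ) z x (hA.inter hC)]
      exact measure_mono Set.inter_subset_left
    · refine Measure.le_iff.2 fun A hA => ?_
      change (τ : ℝ≥0∞) * (obsKernel (Q θ) (g θ) r z x).restrict C A
        ≤ ((εm z * φ θ z x : ℝ≥0) : ℝ≥0∞) * _
      rw [ENNReal.coe_mul, Measure.restrict_apply hA,
        obsKernel_apply (Q θ) (hg θ) z x (hA.inter hC)]
      have h1 : (τ : ℝ≥0∞) * εp z ≤ εm z := by
        have : (τ : ℝ≥0∞) ≤ (εm z : ℝ≥0∞) / εp z :=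
          (hτ.le.trans (min_le_left _ _)).trans (iInf₂_le z hz)
        exact (ENNReal.le_div_iff_mul_le (Or.inl (by exact_mod_cast (hp z).ne'))
          (Or.inl ENNReal.coe_ne_top)).1 this
      refine (mul_le_mul_right ((hdo θ z).2 A hA x hx).2 _).trans ?_
      rw [← mul_assoc, ← mul_assoc]
      exact mul_le_mul' (mul_le_mul' h1 le_rfl) le_rfl
  · have hlik : ∀ x, likelihood (Q θ) (g θ) (Measure.dirac x) z = blockOp (Q θ) (g θ) r z 1 x :=
      fun x => by
        simp_rw [likelihood, likelihoodFrom_eq_blockOp]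
        exact lintegral_dirac' _ (measurable_blockOp (Q θ) (hg θ) r measurable_one z)
    have h1 := (hsup θ z hz).1
    simp_rw [hlik] at h1
    exact (le_iSup₂ (f := fun x (_ : x ∈ Cᶜ) => blockOp (Q θ) (g θ) r z 1 x) x hx).trans
      (h1.trans (mul_le_mul_right (iSup_le hS) _))

variable {Q : Kernel 𝓧 𝓧} [IsMarkovKernel Q] {g : 𝓧 → 𝓨 → ℝ≥0} {y : ℤ → 𝓨} {φ : ℤ → ℝ} {r : ℕ}

/-- The kernels are numbered backwards from the time `e`: index 0 is the last block in time. -/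
theorem iterKernel_obsKernel [MeasurableSpace 𝓨] (hg : Measurable (Function.uncurry g)) (e : ℤ)
    (q n : ℕ) :
    iterKernel (fun k => obsKernel Q g r (block y (e - (k + 1) * r) r)) (windowLik Q g y e q) n
      = windowLik Q g y (e - n * r) (n * r + q) := by
  induction n with
  | zero => simp [iterKernel]
  | succ n ih =>
    funext x
    rw [iterKernel, ih, show (n + 1) * r + q = r + (n * r + q) by ring, windowLik_add' Q hg]
    push_cast
    rw [show e - (n + 1) * (r : ℤ) + r = e - n * r by ring]

theorem prod_expE_windowSum (φ : ℤ → ℝ) (r : ℕ) (e : ℤ) (n : ℕ) :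
    ∏ k ∈ Finset.range n, expE (windowSum φ (e - (k + 1) * r) r) ^ 2
      = expE (2 * windowSum φ (e - n * r) (n * r)) := by
  induction n with
  | zero => simp [windowSum, expE_zero]
  | succ n ih =>
    rw [Finset.prod_range_succ, ih, show (n + 1) * r = r + n * r by ring, windowSum_add]
    push_cast
    rw [show e - (n + 1) * (r : ℤ) + r = e - n * r by ring, ← expE_nat_mul, ← expE_add]
    congr 1
    push_cast
    ring

/-- Split the window into `s` observations, `n` blocks and a tail. The coupling bound applies to the
blocks, with the tail likelihoods of lengths `q + 1` and `q` as terminal functions, and the initial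
piece is then integrated. All suprema and masses combine into one exponential of twice the window
sum. -/
theorem windowLik_mul_le [MeasurableSpace 𝓨] (hg : Measurable (Function.uncurry g))
    (hφ : 0 ≤ φ) (hG : ∀ j x, (g x (y j) : ℝ≥0∞) ≤ expE (φ j)) {K : Set (Fin r → 𝓨)}
    {C : Set 𝓧} {τ ρ η : ℝ≥0} (hC : MeasurableSet C) (hρ : ρ + τ ^ 2 = 1)
    (hdo : ∀ z ∈ K, ∃ (lam : Measure 𝓧) (c : 𝓧 → ℝ≥0), IsFiniteMeasure lam ∧ ∀ x ∈ C,
      c x • lam ≤ obsKernel Q g r z x ∧ τ • (obsKernel Q g r z x).restrict C ≤ c x • lam)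
    (hη : ∀ z ∈ K, ∀ x ∉ C, ∀ S : ℝ≥0∞, (∀ x', blockOp Q g r z 1 x' ≤ S) →
      blockOp Q g r z 1 x ≤ η * S) (i : ℤ) (s n q b : ℕ) (x x' : 𝓧) :
    windowLik Q g y i (s + (n * r + q) + 1) x * windowLik Q g y i (s + (n * r + q)) x'
      ≤ windowLik Q g y i (s + (n * r + q)) x * windowLik Q g y i (s + (n * r + q) + 1) x'
      + (ρ : ℝ≥0∞) ^ (pairCount (fun k : ℕ => block y (i + s + n * r - (k + 1) * r) r ∈ K) n
          - 2 * b)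
        * (windowLik Q g y i (s + (n * r + q) + 1) x * windowLik Q g y i (s + (n * r + q)) x')
      + (η : ℝ≥0∞) ^ b * expE (2 * windowSum φ i (s + (n * r + q) + 1)) := by
  set e : ℤ := i + s + n * r with he
  set κ : ℕ → Prop := fun k : ℕ => block y (e - (k + 1) * r) r ∈ K with hκ
  have hmass : ∀ (t : ℕ) (j : ℤ) (x : 𝓧),
      obsKernel Q g t (block y j t) x Set.univ ≤ expE (windowSum φ j t) := fun t j x => by
    rw [obsKernel_univ Q hg]
    exact windowLik_le hG j t x
  have hblock := iterKernel_mul_le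
    (L := fun k => obsKernel Q g r (block y (e - (k + 1) * r) r))
    (s := fun k => (Real.exp (windowSum φ (e - (k + 1) * r) r)).toNNReal)
    (fun k x => hmass r _ x) (κ := κ) hC hρ (fun k hk => hdo _ hk)
    (fun k hk x hx => by
      rw [obsKernel_univ Q hg]
      exact hη _ hk x hx _ fun x' => windowLik_le hG _ r x')
    (measurable_windowLik Q hg y e (q + 1)) (measurable_windowLik Q hg y e q)
    (fun x => windowLik_le hG e (q + 1) x) (fun x => windowLik_le hG e q x) b n
  rw [iterKernel_obsKernel hg, iterKernel_obsKernel hg] at hblock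
  have hs : i + (s : ℤ) = e - n * r := by rw [he]; ring
  have h1 : ∀ x, windowLik Q g y i (s + (n * r + q)) x
      = ∫⁻ z, windowLik Q g y (e - n * r) (n * r + q) z ∂(obsKernel Q g s (block y i s) x) :=
    fun x => by rw [windowLik_add' Q hg, hs]
  have h2 : ∀ x, windowLik Q g y i (s + (n * r + q) + 1) x
      = ∫⁻ z, windowLik Q g y (e - n * r) (n * r + (q + 1)) z
        ∂(obsKernel Q g s (block y i s) x) :=
    fun x => by rw [← hs, ← windowLik_add' Q hg]; rfl
  have hfin : ∀ x, IsFiniteMeasure (obsKernel Q g s (block y i s) x) := fun x =>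
    ⟨(hmass s i x).trans_lt (expE_ne_top _).lt_top⟩
  have := lintegral_mul_le_of_forall (L := obsKernel Q g s (block y i s) x)
    (L' := obsKernel Q g s (block y i s) x') (measurable_windowLik Q hg y _ _)
    (measurable_windowLik Q hg y _ _) hblock
  rw [← h1, ← h1, ← h2, ← h2] at this
  refine this.trans (add_le_add le_rfl ?_)
  rw [mul_assoc]
  refine mul_le_mul_right ?_ _
  refine (mul_le_mul_right (mul_le_mul' (hmass s i x) (hmass s i x')) _).trans ?_
  have hprod : ∏ k ∈ Finset.range n,
      (((Real.exp (windowSum φ (e - (k + 1) * r) r)).toNNReal : ℝ≥0) : ℝ≥0∞) ^ 2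
      = expE (2 * windowSum φ (e - n * r) (n * r)) := prod_expE_windowSum φ r e n
  rw [hprod, ← expE_add, ← expE_add, ← expE_add, ← expE_add, expE_le,
    show s + (n * r + q) + 1 = s + (n * r + (q + 1)) by ring, windowSum_add φ i, hs,
    windowSum_add φ (e - n * r),
    show e - n * (r : ℤ) + ((n * r : ℕ) : ℤ) = e by push_cast; ring]
  have := windowSum_mono hφ e (Nat.le_succ q)
  simp only [Nat.succ_eq_add_one] at this
  linarith

theorem sum_range_mul_eq (ψ : ℕ → ℝ) (r n : ℕ) :
    ∑ k ∈ Finset.range (n * r), ψ k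
      = ∑ s ∈ Finset.range r, ∑ j ∈ Finset.range n, ψ (j * r + s) := by
  induction n with
  | zero => simp
  | succ n ih =>
    simp_rw [Finset.sum_range_succ, Finset.sum_add_distrib, ← ih, add_mul, one_mul,
      Finset.sum_range_add]

/-- Pigeonhole over the residues modulo `r`: some phase has at most the average. This turns a
frequency over all times into one over disjoint blocks. -/
theorem exists_phase_sum_le (ψ : ℕ → ℝ) {r : ℕ} (hr : 1 ≤ r) (n : ℕ) {B : ℝ}
    (hB : ∑ k ∈ Finset.range (n * r), ψ k ≤ B) :
    ∃ s < r, ∑ j ∈ Finset.range n, ψ (j * r + s) ≤ B / r := by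
  rw [sum_range_mul_eq] at hB
  have hr0 : (0 : ℝ) < r := by exact_mod_cast hr
  obtain ⟨s, hs, h⟩ := Finset.exists_le_of_sum_le (s := Finset.range r)
    (f := fun s => ∑ j ∈ Finset.range n, ψ (j * r + s)) (g := fun _ => B / r)
    ⟨0, Finset.mem_range.2 hr⟩
    (by rw [Finset.sum_const, Finset.card_range, nsmul_eq_mul, mul_div_cancel₀ _ hr0.ne']
        exact hB)
  exact ⟨s, Finset.mem_range.1 hs, h⟩

/-- Growth conditions on an observation path: the weights `φ` control `g` from above and the
minorization on `D` from below, they grow linearly, and at most about a third of the blocks lie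
outside `K`. -/
structure RegularPath (Q : Kernel 𝓧 𝓧) (g : 𝓧 → 𝓨 → ℝ≥0) (K : Set (Fin r → 𝓨)) (D : Set 𝓧)
    (y : ℤ → 𝓨) (φ : ℤ → ℝ) (c A : ℝ) : Prop where
  nonneg : 0 ≤ φ
  le_weight : ∀ j x, (g x (y j) : ℝ≥0∞) ≤ expE (φ j)
  minoration : ∀ j, ∀ x ∈ D, expE (-φ j) ≤ blockKernel Q g (block y j r) x D
  sum_le : ∀ m N : ℕ, windowSum φ (-m) N ≤ c * (m + N) + A
  bad_le : ∀ m N : ℕ, m ≤ N →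
    windowSum (fun j => Kᶜ.indicator 1 (block y j r)) (-m) N ≤ N / 3 + A

/-- The rate `β` of the additive error is prescribed in advance, at the price of the rate `α`. This
freedom is what later lets the additive error fall below the square of the likelihoods. -/
theorem RegularPath.exists_windowLik_mul_le [MeasurableSpace 𝓨]
    (hg : Measurable (Function.uncurry g)) {K : Set (Fin r → 𝓨)} {D : Set 𝓧} {c A : ℝ}
    (hreg : RegularPath Q g K D y φ c A) (hc : 0 ≤ c) (hr : 1 ≤ r)
    (hK : HasDoeblinBlocks Q g K) {β : ℝ} (hβ : 0 ≤ β) :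
    ∃ α > 0, ∃ N₀ : ℕ, ∀ m N : ℕ, m ≤ N → N₀ ≤ N → ∀ x x',
      windowLik Q g y (-m) (N + 1) x * windowLik Q g y (-m) N x'
        ≤ windowLik Q g y (-m) N x * windowLik Q g y (-m) (N + 1) x'
        + expE (-(α * N)) * (windowLik Q g y (-m) (N + 1) x * windowLik Q g y (-m) N x')
        + expE (-(β * N)) := by
  classical
  have hr0 : (0 : ℝ) < r := by exact_mod_cast hr
  have hr1 : (1 : ℝ) ≤ r := by exact_mod_cast hr
  have hA : 0 ≤ A := by
    have := hreg.sum_le 0 0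
    simpa [windowSum] using this
  -- With about `N / (12 r)` visits allowed, `η = exp (-ξ)` contributes `exp (-(β + 4c + 1) N)`. The
  -- part `4c` offsets twice the window sum, as `m ≤ N`, and the last 1 absorbs the constants.
  set ξ : ℝ := 12 * r * (β + 4 * c + 1) with hξ
  have hξ0 : 0 ≤ ξ := by positivity
  obtain ⟨C, τ, ρ, hC, hτ, hρ, hdo, hout⟩ := hK (Real.exp (-ξ)).toNNReal
    (Real.toNNReal_pos.2 (Real.exp_pos _))
  have hρ1 : ρ < 1 := by
    have : 0 < τ ^ 2 := pow_pos hτ 2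
    rw [← hρ]
    exact lt_add_of_pos_right ρ this
  obtain ⟨γ, hγ, hργ⟩ : ∃ γ : ℝ, 0 < γ ∧ (ρ : ℝ≥0∞) ≤ expE (-γ) := by
    -- The maximum with `1 / 2` covers `ρ = 0`, where the logarithm would give no rate.
    have h1 : max (ρ : ℝ) (1 / 2) < 1 := max_lt (by exact_mod_cast hρ1) (by norm_num)
    have h0 : 0 < max (ρ : ℝ) (1 / 2) := lt_max_of_lt_right (by norm_num)
    refine ⟨-Real.log (max (ρ : ℝ) (1 / 2)), neg_pos.2 (Real.log_neg h0 h1), ?_⟩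
    rw [neg_neg, expE, Real.exp_log h0, ← ENNReal.ofReal_coe_nnreal]
    exact ENNReal.ofReal_le_ofReal (le_max_left _ _)
  refine ⟨γ / (12 * r), by positivity,
    ⌈12 * r * (3 + 2 * A) + (2 * ξ + 2 * c + 2 * A)⌉₊ + r, fun m N hmN hN x x' => ?_⟩
  have hNr : r ≤ N := le_trans (Nat.le_add_left _ _) hN
  have hNreal : 12 * r * (3 + 2 * A) + (2 * ξ + 2 * c + 2 * A) ≤ (N : ℝ) := by
    refine (Nat.le_ceil _).trans ?_
    exact_mod_cast (Nat.le_add_right _ _).trans hN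
  -- One block is given up to leave room for a phase `s < r`.
  set n : ℕ := N / r - 1 with hn
  have hdiv : 1 ≤ N / r := (Nat.one_le_div_iff hr).2 hNr
  have hnr : n * r + r ≤ N := by
    have := Nat.div_mul_le_self N r
    calc n * r + r = (n + 1) * r := by ring
      _ = N / r * r := by rw [hn, Nat.sub_add_cancel hdiv]
      _ ≤ N := this
  have hNn : (N : ℝ) ≤ n * r + 2 * r := by
    have h1 : N < (N / r + 1) * r := by
      have := Nat.lt_mul_div_succ N hr
      rwa [mul_comm] at this
    have h2 : N / r + 1 = n + 2 := by omega
    rw [h2] at h1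
    have : (N : ℝ) < (n + 2) * r := by exact_mod_cast h1
    linarith
  set ψ : ℤ → ℝ := fun j => Kᶜ.indicator 1 (block y j r) with hψ
  have hψ0 : 0 ≤ ψ := fun j => Set.indicator_nonneg (fun _ _ => zero_le_one) _
  obtain ⟨s, hs, hphase⟩ := exists_phase_sum_le (fun k : ℕ => ψ (-m + k)) hr n
    (B := N / 3 + A)
    ((windowSum_mono hψ0 (-(m : ℤ)) (by omega : n * r ≤ N)).trans (hreg.bad_le m N hmN))
  obtain ⟨q, hq⟩ : ∃ q, N = s + (n * r + q) := ⟨N - s - n * r, by omega⟩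
  set κ : ℕ → Prop := fun k => block y (-(m : ℤ) + s + n * r - (k + 1) * r) r ∈ K with hκ
  have hcard : (n : ℝ) - (N / 3 + A) / r ≤ ((Finset.range n).filter κ).card := by
    have h1 : ∑ k ∈ Finset.range n, ψ (-(m : ℤ) + s + n * r - (k + 1) * r)
        = ∑ j ∈ Finset.range n, ψ (-m + ((j * r + s : ℕ) : ℤ)) := by
      rw [← Finset.sum_range_reflect]
      refine Finset.sum_congr rfl fun k hk => ?_
      congr 1
      have hk' := Finset.mem_range.1 hk
      rw [show ((n - 1 - k : ℕ) : ℤ) = n - 1 - k by omega]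
      push_cast
      ring
    have h2 : (((Finset.range n).filter κ).card : ℝ)
        = n - ∑ k ∈ Finset.range n, ψ (-(m : ℤ) + s + n * r - (k + 1) * r) := by
      rw [Finset.card_filter]
      push_cast
      rw [eq_sub_iff_add_eq, ← Finset.sum_add_distrib]
      rw [Finset.sum_congr rfl (g := fun _ => (1 : ℝ)) fun k _ => ?_]
      · simp
      · by_cases hk : κ k
        · simp only [hκ] at hk
          simp [hψ, hk]
        · simp only [hκ] at hk
          simp [hψ, hk]
    rw [h2, h1]
    linarith
  have hbad : (N / 3 + A) / r ≤ (n + 2) / 3 + A := by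
    rw [div_le_iff₀ hr0]
    nlinarith
  have hpair := two_mul_card_le_pairCount κ n
  have hpair' : 2 * (((Finset.range n).filter κ).card : ℝ) ≤ pairCount κ n + n + 1 := by
    exact_mod_cast hpair
  -- About `2n/3` good blocks give about `n/3` pairs. The budget removes at most `n/6` of them, and
  -- the remaining `n/6` exceeds `N / (12 r)` for large `N`.
  set b : ℕ := n / 12 with hb
  have hb1 : 12 * (b : ℝ) ≤ n := by
    have := Nat.mul_div_le n 12
    exact_mod_cast this
  have hb2 : (n : ℝ) ≤ 12 * b + 12 := by
    have : n ≤ 12 * b + 12 := by omega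
    exact_mod_cast this
  have hexp : (pairCount κ n : ℝ) - 2 * b ≤ ((pairCount κ n - 2 * b : ℕ) : ℝ) := by
    have : pairCount κ n ≤ (pairCount κ n - 2 * b) + 2 * b := by omega
    have h' : (pairCount κ n : ℝ) ≤ ((pairCount κ n - 2 * b : ℕ) : ℝ) + 2 * b := by
      exact_mod_cast this
    linarith
  have hNr' : (N : ℝ) / r ≤ n + 2 := by
    rw [div_le_iff₀ hr0]
    linarith
  have hmain := windowLik_mul_le (Q := Q) (y := y) hg hreg.nonneg hreg.le_weight hC hρ hdo hout
    (-(m : ℤ)) s n q b x x'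
  rw [← hq] at hmain
  refine hmain.trans (add_le_add (add_le_add le_rfl (mul_le_mul' ?_ le_rfl)) ?_)
  · refine (pow_le_pow_left' hργ _).trans ?_
    rw [← expE_nat_mul, expE_le]
    have h1 : (N : ℝ) / (12 * r) ≤ ((pairCount κ n - 2 * b : ℕ) : ℝ) := by
      have h2 : 3 + 2 * A ≤ N / (12 * r) := by
        rw [le_div_iff₀ (by positivity)]
        nlinarith
      have h3 : (N : ℝ) / r = 12 * (N / (12 * r)) := by field_simp
      linarith
    have h4 : γ / (12 * r) * N = N / (12 * r) * γ := by ring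
    nlinarith
  · have h1 : ((Real.exp (-ξ)).toNNReal : ℝ≥0∞) = expE (-ξ) := rfl
    rw [h1, ← expE_nat_mul, ← expE_add, expE_le]
    have h2 := hreg.sum_le m (N + 1)
    have h3 : (m : ℝ) ≤ N := by exact_mod_cast hmN
    push_cast at h2
    have h4 : (N : ℝ) / (12 * r) - 2 ≤ b := by
      have h3 : (N : ℝ) / r = 12 * (N / (12 * r)) := by field_simp
      linarith
    have h5 : ξ * (N / (12 * r)) = (β + 4 * c + 1) * N := by
      rw [hξ]; field_simp
    have h6 := mul_le_mul_of_nonneg_left h4 hξ0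
    have h7 : 0 ≤ 12 * r * (3 + 2 * A) := by positivity
    nlinarith

end Exchange

/-! ### Exponential forgetting and limits of predictive densities. -/

section Forgetting

theorem abs_log_sub_log_le {V₁ v₁ V₂ v₂ δ : ℝ} (hV₁ : 0 < V₁) (hv₁ : 0 < v₁) (hV₂ : 0 < V₂)
    (hv₂ : 0 < v₂) (hδ0 : 0 ≤ δ) (hδ : δ ≤ 1 / 2) (h₁ : V₁ * v₂ * (1 - δ) ≤ v₁ * V₂)
    (h₂ : V₂ * v₁ * (1 - δ) ≤ v₂ * V₁) :
    |(Real.log V₁ - Real.log v₁) - (Real.log V₂ - Real.log v₂)| ≤ 2 * δ := by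
  have hpos : 0 < 1 - δ := by linarith
  have hlog : -(2 * δ) ≤ Real.log (1 - δ) := by
    have h := Real.one_sub_inv_le_log_of_pos hpos
    have : (1 - δ)⁻¹ ≤ 1 + 2 * δ := by
      rw [inv_le_iff_one_le_mul₀ hpos]
      nlinarith
    linarith
  have e₁ := Real.log_le_log (by positivity) h₁
  have e₂ := Real.log_le_log (by positivity) h₂
  rw [Real.log_mul (by positivity) hpos.ne', Real.log_mul hV₁.ne' hv₂.ne',
    Real.log_mul hv₁.ne' hV₂.ne'] at e₁
  rw [Real.log_mul (by positivity) hpos.ne', Real.log_mul hV₂.ne' hv₁.ne',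
    Real.log_mul hv₂.ne' hV₁.ne'] at e₂
  rw [abs_le]
  constructor <;> linarith

variable {𝓧 𝓨 : Type*} [MeasurableSpace 𝓧] {Q : Kernel 𝓧 𝓧} [IsMarkovKernel Q]
  {g : 𝓧 → 𝓨 → ℝ≥0} {y : ℤ → 𝓨} {φ : ℤ → ℝ} {r : ℕ}

/-- Logarithm of the likelihood of the window `i, …, i + t - 1` for the initial measure `μ`. -/
def logLik (Q : Kernel 𝓧 𝓧) (g : 𝓧 → 𝓨 → ℝ≥0) (μ : Measure 𝓧) (y : ℤ → 𝓨) (i : ℤ) (t : ℕ) : ℝ :=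
  Real.log (∫⁻ x, windowLik Q g y i t x ∂μ).toReal

/-- The lower bounds on `V₁` and `v₂` make the additive error a small multiple of `V₁ * v₂`. -/
theorem mul_toReal_le_of_expE {V₁ v₁ V₂ v₂ E : ℝ≥0∞} {a B e : ℝ} (hV₁ : V₁ ≠ ∞) (hv₁ : v₁ ≠ ∞)
    (hV₂ : V₂ ≠ ∞) (hv₂ : v₂ ≠ ∞) (hlV₁ : expE (-B) ≤ V₁) (hlv₂ : expE (-B) ≤ v₂)
    (hE : E ≤ expE (-(2 * B) - e))
    (h : V₁ * v₂ ≤ v₁ * V₂ + expE (-a) * (V₁ * v₂) + E) :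
    V₁.toReal * v₂.toReal * (1 - (Real.exp (-a) + Real.exp (-e))) ≤ v₁.toReal * V₂.toReal := by
  have h1 : E ≤ expE (-e) * (V₁ * v₂) := by
    refine hE.trans ?_
    rw [show -(2 * B) - e = -e + (-B + -B) by ring, expE_add, expE_add (-B)]
    exact mul_le_mul_right (mul_le_mul' hlV₁ hlv₂) _
  have h2 := h.trans (add_le_add le_rfl h1)
  have f1 : v₁ * V₂ ≠ ∞ := ENNReal.mul_ne_top hv₁ hV₂
  have f2 : ∀ t, expE t * (V₁ * v₂) ≠ ∞ := fun t =>
    ENNReal.mul_ne_top (expE_ne_top t) (ENNReal.mul_ne_top hV₁ hv₂)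
  have h3 := ENNReal.toReal_mono (ENNReal.add_ne_top.2 ⟨ENNReal.add_ne_top.2 ⟨f1, f2 _⟩, f2 _⟩) h2
  rw [ENNReal.toReal_add (ENNReal.add_ne_top.2 ⟨f1, f2 _⟩) (f2 _),
    ENNReal.toReal_add f1 (f2 _)] at h3
  simp only [ENNReal.toReal_mul, expE, ENNReal.toReal_ofReal (Real.exp_pos _).le] at h3
  linarith

/-- The log-ratio of the likelihoods of two successive windows forgets the initial measure at an
exponential rate. -/
theorem RegularPath.exists_abs_logLik_sub_le [MeasurableSpace 𝓨]
    (hg : Measurable (Function.uncurry g)) {K : Set (Fin r → 𝓨)} {D : Set 𝓧} {c A : ℝ}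
    (hreg : RegularPath Q g K D y φ c A) (hc : 0 ≤ c) (hr : 1 ≤ r)
    (hK : HasDoeblinBlocks Q g K) {B₀ B₁ : ℝ} (hB₀ : 0 ≤ B₀) :
    ∃ α > 0, ∃ N₀ : ℕ, ∀ m N : ℕ, m ≤ N → N₀ ≤ N → ∀ μ₁ μ₂ : Measure 𝓧,
      (∀ μ : Measure 𝓧, μ = μ₁ ∨ μ = μ₂ → μ Set.univ ≤ expE (B₀ * N + B₁) ∧
        expE (-(B₀ * N + B₁)) ≤ ∫⁻ x, windowLik Q g y (-m) N x ∂μ ∧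
        expE (-(B₀ * N + B₁)) ≤ ∫⁻ x, windowLik Q g y (-m) (N + 1) x ∂μ) →
      |(logLik Q g μ₁ y (-m) (N + 1) - logLik Q g μ₁ y (-m) N)
        - (logLik Q g μ₂ y (-m) (N + 1) - logLik Q g μ₂ y (-m) N)| ≤ 4 * Real.exp (-(α * N)) := by
  -- The two masses and the two lower bounds each cost `exp B`, in all `exp (4 B₀ N + 4 B₁)`. For `N
  -- ≥ 4 B₁` the surplus 2 in the rate still leaves `exp (-N)`.
  obtain ⟨α₀, hα₀, N₀, hN₀⟩ := hreg.exists_windowLik_mul_le hg hc hr hK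
    (β := 4 * B₀ + 2) (by positivity)
  set α := min α₀ 1 with hα
  have hαpos : 0 < α := lt_min hα₀ one_pos
  refine ⟨α, hαpos, max N₀ (⌈4 * B₁⌉₊ + ⌈2 / α⌉₊), fun m N hmN hN μ₁ μ₂ hμ => ?_⟩
  have hNN := hN₀ m N hmN ((le_max_left _ _).trans hN)
  have hN1 : 4 * B₁ ≤ N := (Nat.le_ceil _).trans (by
    exact_mod_cast (Nat.le_add_right _ _).trans ((le_max_right _ _).trans hN))
  have hN2 : 2 ≤ α * N := by
    have : 2 / α ≤ N := (Nat.le_ceil _).trans (by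
      exact_mod_cast (Nat.le_add_left _ _).trans ((le_max_right _ _).trans hN))
    rw [div_le_iff₀ hαpos] at this
    linarith
  set V := windowLik Q g y (-m) (N + 1)
  set v := windowLik Q g y (-m) N
  set B : ℝ := B₀ * N + B₁ with hB
  have hVm : Measurable V := measurable_windowLik Q hg y _ _
  have hvm : Measurable v := measurable_windowLik Q hg y _ _
  obtain ⟨hm₁, hv₁, hV₁⟩ := hμ μ₁ (Or.inl rfl)
  obtain ⟨hm₂, hv₂, hV₂⟩ := hμ μ₂ (Or.inr rfl)
  have hf₁ : IsFiniteMeasure μ₁ := ⟨hm₁.trans_lt (expE_ne_top _).lt_top⟩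
  have hf₂ : IsFiniteMeasure μ₂ := ⟨hm₂.trans_lt (expE_ne_top _).lt_top⟩
  have hfin : ∀ (μ : Measure 𝓧) [IsFiniteMeasure μ] (t : ℕ),
      ∫⁻ x, windowLik Q g y (-m) t x ∂μ ≠ ∞ := fun μ _ t => by
    refine ((lintegral_mono fun x => windowLik_le hreg.le_weight _ t x).trans_lt ?_).ne
    rw [lintegral_const]
    exact ENNReal.mul_lt_top (expE_ne_top _).lt_top (measure_lt_top _ _)
  have hpos : ∀ {a : ℝ≥0∞}, expE (-B) ≤ a → a ≠ ∞ → 0 < a.toReal := fun h h' =>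
    ENNReal.toReal_pos ((expE_pos _).trans_le h).ne' h'
  have hE : ∀ {a b : ℝ≥0∞}, a ≤ expE B → b ≤ expE B →
      expE (-((4 * B₀ + 2) * N)) * (a * b) ≤ expE (-(2 * B) - N) := fun ha hb => by
    refine (mul_le_mul_right (mul_le_mul' ha hb) _).trans ?_
    rw [← expE_add, ← expE_add, expE_le, hB]
    linarith
  have hNle : Real.exp (-(α₀ * N)) + Real.exp (-(N : ℝ)) ≤ 2 * Real.exp (-(α * N)) := by
    have hN0 : (0 : ℝ) ≤ N := N.cast_nonneg
    have h1 : Real.exp (-(α₀ * N)) ≤ Real.exp (-(α * N)) := by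
      refine Real.exp_le_exp.2 (neg_le_neg ?_)
      exact mul_le_mul_of_nonneg_right (min_le_left _ _) hN0
    have h2 : Real.exp (-(N : ℝ)) ≤ Real.exp (-(α * N)) := by
      refine Real.exp_le_exp.2 (neg_le_neg ?_)
      exact mul_le_of_le_one_left hN0 (min_le_right _ _)
    linarith
  have hexp : Real.exp (-(α * N)) ≤ 1 / 4 := by
    have h1 : Real.exp (-(α * N)) ≤ Real.exp (-2) := Real.exp_le_exp.2 (by linarith)
    have h2 : Real.exp (-2 : ℝ) ≤ 1 / 4 := by
      rw [Real.exp_neg, inv_eq_one_div]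
      have h3 : (4 : ℝ) ≤ Real.exp 2 := by
        have h4 : (2 : ℝ) ≤ Real.exp 1 := by linarith [Real.add_one_le_exp (1 : ℝ)]
        rw [show (2 : ℝ) = 1 + 1 by norm_num, Real.exp_add]
        nlinarith
      exact one_div_le_one_div_of_le (by norm_num) h3
    exact h1.trans h2
  have key : ∀ (μ μ' : Measure 𝓧) [IsFiniteMeasure μ] [IsFiniteMeasure μ'],
      μ Set.univ ≤ expE B → μ' Set.univ ≤ expE B → expE (-B) ≤ ∫⁻ x, V x ∂μ →
      expE (-B) ≤ ∫⁻ x, v x ∂μ' →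
      (∫⁻ x, V x ∂μ).toReal * (∫⁻ x, v x ∂μ').toReal * (1 - 2 * Real.exp (-(α * N)))
        ≤ (∫⁻ x, v x ∂μ).toReal * (∫⁻ x, V x ∂μ').toReal := by
    intro μ μ' _ _ hm hm' hV hv
    have h1 := lintegral_mul_le_of_forall (L := μ) (L' := μ') hVm hvm hNN
    have h2 := mul_toReal_le_of_expE (hfin μ _) (hfin μ _) (hfin μ' _) (hfin μ' _) hV hv
      (hE hm hm') h1
    refine le_trans ?_ h2
    gcongr
  have := abs_log_sub_log_le (hpos hV₁ (hfin μ₁ _)) (hpos hv₁ (hfin μ₁ _)) (hpos hV₂ (hfin μ₂ _))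
    (hpos hv₂ (hfin μ₂ _)) (δ := 2 * Real.exp (-(α * N))) (by positivity) (by linarith)
    (key μ₁ μ₂ hm₁ hm₂ hV₁ hv₂) (key μ₂ μ₁ hm₂ hm₁ hV₂ hv₁)
  refine this.trans (le_of_eq ?_)
  ring

/-- The initial distribution `χ` charges `D` after one block, with a loss controlled by `φ`. -/
def ChargesD (Q : Kernel 𝓧 𝓧) (g : 𝓧 → 𝓨 → ℝ≥0) (r : ℕ) (D : Set 𝓧) (y : ℤ → 𝓨) (φ : ℤ → ℝ)
    (χ : Measure 𝓧) : Prop :=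
  ∀ i : ℤ, expE (-φ i) ≤ ∫⁻ x, blockKernel Q g (block y i r) x D ∂χ

theorem RegularPath.expE_le_lintegral [MeasurableSpace 𝓨]
    (hg : Measurable (Function.uncurry g)) {K : Set (Fin r → 𝓨)} {D : Set 𝓧} {c A : ℝ}
    (hreg : RegularPath Q g K D y φ c A) (hr : 1 ≤ r) (hD : MeasurableSet D) {χ : Measure 𝓧}
    (hχ : ChargesD Q g r D y φ χ) (m N : ℕ) :
    expE (-(2 * (c * (m + N + r) + A))) ≤ ∫⁻ x, windowLik Q g y (-m) N x ∂χ := by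
  refine le_trans (expE_le.2 ?_) (expE_le_lintegral_windowLik hg hreg.nonneg hreg.le_weight hr hD
    hreg.minoration (hχ _) N)
  have := hreg.sum_le m (N + r)
  push_cast at this
  linarith

theorem RegularPath.lintegral_ne_top {K : Set (Fin r → 𝓨)} {D : Set 𝓧} {c A : ℝ}
    (hreg : RegularPath Q g K D y φ c A) (χ : Measure 𝓧) [IsFiniteMeasure χ] (i : ℤ) (N : ℕ) :
    ∫⁻ x, windowLik Q g y i N x ∂χ ≠ ∞ := by
  refine ((lintegral_mono fun x => windowLik_le hreg.le_weight _ N x).trans_lt ?_).ne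
  rw [lintegral_const]
  exact ENNReal.mul_lt_top (expE_ne_top _).lt_top (measure_lt_top _ _)

theorem RegularPath.lintegral_pos [MeasurableSpace 𝓨]
    (hg : Measurable (Function.uncurry g)) {K : Set (Fin r → 𝓨)} {D : Set 𝓧} {c A : ℝ}
    (hreg : RegularPath Q g K D y φ c A) (hr : 1 ≤ r) (hD : MeasurableSet D) {χ : Measure 𝓧}
    (hχ : ChargesD Q g r D y φ χ) (m N : ℕ) : 0 < ∫⁻ x, windowLik Q g y (-m) N x ∂χ :=
  (expE_pos _).trans_le (hreg.expE_le_lintegral hg hr hD hχ m N)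

/-- Log of the predictive density of `y_k` given `y_{-m}, …, y_{k-1}`. -/
def logPred (Q : Kernel 𝓧 𝓧) (g : 𝓧 → 𝓨 → ℝ≥0) (χ : Measure 𝓧) (y : ℤ → 𝓨) (m k : ℕ) : ℝ :=
  logLik Q g χ y (-m) (m + k + 1) - logLik Q g χ y (-m) (m + k)

theorem sum_logPred (Q : Kernel 𝓧 𝓧) (g : 𝓧 → 𝓨 → ℝ≥0) (χ : Measure 𝓧) [IsProbabilityMeasure χ]
    (y : ℤ → 𝓨) (n : ℕ) : ∑ k ∈ Finset.range n, logPred Q g χ y 0 k = logLik Q g χ y 0 n := by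
  simp only [logPred, Nat.cast_zero, neg_zero, Nat.zero_add]
  rw [Finset.sum_range_sub]
  simp [logLik, windowLik_zero]

theorem RegularPath.expE_logPred [MeasurableSpace 𝓨]
    (hg : Measurable (Function.uncurry g)) {K : Set (Fin r → 𝓨)} {D : Set 𝓧} {c A : ℝ}
    (hreg : RegularPath Q g K D y φ c A) (hr : 1 ≤ r) (hD : MeasurableSet D) {χ : Measure 𝓧}
    [IsProbabilityMeasure χ] (hχ : ChargesD Q g r D y φ χ) (m : ℕ) :
    predictive Q g χ y m = expE (logPred Q g χ y m 0) := by
  have h0 : ∀ N, 0 < (∫⁻ x, windowLik Q g y (-m) N x ∂χ).toReal := fun N =>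
    ENNReal.toReal_pos (hreg.lintegral_pos hg hr hD hχ m N).ne' (hreg.lintegral_ne_top χ _ N)
  rw [predictive, likelihood_block, likelihood_block, logPred, Nat.add_zero, logLik, logLik,
    ← Real.log_div (h0 _).ne' (h0 _).ne', expE, Real.exp_log (div_pos (h0 _) (h0 _)),
    ENNReal.ofReal_div_of_pos (h0 _), ENNReal.ofReal_toReal (hreg.lintegral_ne_top χ _ _),
    ENNReal.ofReal_toReal (hreg.lintegral_ne_top χ _ _)]
  rfl

theorem RegularPath.logPred_le [MeasurableSpace 𝓨]
    (hg : Measurable (Function.uncurry g)) {K : Set (Fin r → 𝓨)} {D : Set 𝓧} {c A : ℝ}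
    (hreg : RegularPath Q g K D y φ c A) (hr : 1 ≤ r) (hD : MeasurableSet D) {χ : Measure 𝓧}
    [IsProbabilityMeasure χ] (hχ : ChargesD Q g r D y φ χ) (m k : ℕ) :
    logPred Q g χ y m k ≤ φ k := by
  have h0 : ∀ N, 0 < (∫⁻ x, windowLik Q g y (-m) N x ∂χ).toReal := fun N =>
    ENNReal.toReal_pos (hreg.lintegral_pos hg hr hD hχ m N).ne' (hreg.lintegral_ne_top χ _ N)
  have h1 := lintegral_mono (μ := χ) fun x =>
    windowLik_add_le (Q := Q) hg hreg.le_weight (-(m : ℤ)) (m + k) 1 x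
  rw [lintegral_const_mul' _ _ (expE_ne_top _), windowSum_one,
    show -(m : ℤ) + ((m + k : ℕ) : ℤ) = k by push_cast; ring] at h1
  have h2 := ENNReal.toReal_mono
    (ENNReal.mul_ne_top (expE_ne_top _) (hreg.lintegral_ne_top χ _ _)) h1
  rw [ENNReal.toReal_mul, expE, ENNReal.toReal_ofReal (Real.exp_pos _).le] at h2
  have h3 := Real.log_le_log (h0 _) h2
  rw [Real.log_mul (Real.exp_pos _).ne' (h0 _).ne', Real.log_exp] at h3
  rw [logPred, logLik, logLik]
  linarith

/-- Adding one past observation replaces `χ` at time `-m` by an unnormalized propagated measure, so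
successive terms differ by a geometric error in `m + k`. Summing over `m` gives the limit; summing
from `m = 0` leaves an error of order `ϱ ^ k`, which gives the second claim. -/
theorem RegularPath.exists_limit_logPred [MeasurableSpace 𝓨]
    (hg : Measurable (Function.uncurry g)) {K : Set (Fin r → 𝓨)} {D : Set 𝓧} {c A : ℝ}
    (hreg : RegularPath Q g K D y φ c A) (hc : 0 ≤ c) (hr : 1 ≤ r) (hD : MeasurableSet D)
    (hK : HasDoeblinBlocks Q g K) {χ : Measure 𝓧} [IsProbabilityMeasure χ]
    (hχ : ChargesD Q g r D y φ χ) :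
    ∃ l : ℕ → ℝ, (∀ k, Tendsto (fun m => logPred Q g χ y m k) atTop (𝓝 (l k))) ∧
      Tendsto (fun k => logPred Q g χ y 0 k - l k) atTop (𝓝 0) := by
  have hA : 0 ≤ A := by
    have := hreg.sum_le 0 0
    simpa [windowSum] using this
  obtain ⟨α, hα, N₀, hN₀⟩ := hreg.exists_abs_logLik_sub_le hg hc hr hK
    (B₀ := 4 * c) (B₁ := 2 * (c * (3 + r) + A)) (by positivity)
  have hstep : ∀ m k, N₀ ≤ m + k →
      dist (logPred Q g χ y m k) (logPred Q g χ y (m + 1) k)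
        ≤ 4 * Real.exp (-(α * (m + k : ℕ))) := by
    intro m k hmk
    -- `χ'` is `χ` moved from time `-(m + 1)` to `-m`. It is not normalized, which is why forgetting
    -- is stated for measures of controlled mass.
    set χ' : Measure 𝓧 := χ.bind (obsKernel Q g 1 (block y (-((m + 1 : ℕ) : ℤ)) 1)) with hχ'
    have hlik : ∀ t, ∫⁻ x, windowLik Q g y (-m) t x ∂χ'
        = ∫⁻ x, windowLik Q g y (-((m + 1 : ℕ) : ℤ)) (t + 1) x ∂χ := fun t => by
      rw [hχ', Measure.lintegral_bind (Kernel.aemeasurable _)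
        (measurable_windowLik Q hg y _ _).aemeasurable]
      refine lintegral_congr fun x => ?_
      rw [add_comm t, windowLik_add' Q hg]
      rw [show -((m + 1 : ℕ) : ℤ) + ((1 : ℕ) : ℤ) = -m by push_cast; ring]
    have hlog : ∀ t, logLik Q g χ' y (-m) t = logLik Q g χ y (-((m + 1 : ℕ) : ℤ)) (t + 1) :=
      fun t => by rw [logLik, logLik, hlik]
    have hmk' : (m : ℝ) ≤ (m + k : ℕ) := by exact_mod_cast Nat.le_add_right m k
    have hcr : 0 ≤ c * r := by positivity
    have hcm : c * m ≤ c * (m + k : ℕ) := mul_le_mul_of_nonneg_left hmk' hc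
    have hcm0 : 0 ≤ c * m := by positivity
    have hmass : χ' Set.univ ≤ expE (c * (m + 1 + 1) + A) := by
      rw [hχ', Measure.bind_apply MeasurableSet.univ (Kernel.aemeasurable _)]
      refine (lintegral_mono fun x => ?_).trans (by
        rw [lintegral_const, measure_univ, mul_one])
      rw [obsKernel_univ Q hg]
      refine (windowLik_le (Q := Q) hreg.le_weight _ 1 x).trans (expE_le.2 ?_)
      have := hreg.sum_le (m + 1) 1
      push_cast at this ⊢
      exact this
    have := hN₀ m (m + k) (Nat.le_add_right m k) hmk χ χ' (by
      rintro μ (rfl | rfl)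
      · refine ⟨?_, (expE_le.2 ?_).trans (hreg.expE_le_lintegral hg hr hD hχ m _),
          (expE_le.2 ?_).trans (hreg.expE_le_lintegral hg hr hD hχ m _)⟩
        · rw [measure_univ, ← expE_zero, expE_le]
          positivity
        · linarith
        · push_cast at *; linarith
      · rw [hlik, hlik]
        refine ⟨hmass.trans (expE_le.2 ?_),
          (expE_le.2 ?_).trans (hreg.expE_le_lintegral hg hr hD hχ (m + 1) _),
          (expE_le.2 ?_).trans (hreg.expE_le_lintegral hg hr hD hχ (m + 1) _)⟩
        · push_cast at *; linarith
        · push_cast at *; linarith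
        · push_cast at *; linarith)
    rw [hlog, hlog] at this
    rw [Real.dist_eq, logPred, logPred, show m + 1 + k = m + k + 1 by ring]
    exact this
  set ϱ := Real.exp (-α) with hϱ
  have hϱ1 : ϱ < 1 := by rw [hϱ, Real.exp_lt_one_iff]; linarith
  have hϱ0 : 0 < ϱ := Real.exp_pos _
  have hpow : ∀ n : ℕ, Real.exp (-(α * n)) = ϱ ^ n := fun n => by
    rw [hϱ, ← Real.exp_nat_mul]
    ring_nf
  have hgeo : ∀ M k, N₀ ≤ M + k → ∀ n, dist (logPred Q g χ y (n + M) k)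
      (logPred Q g χ y (n + 1 + M) k) ≤ 4 * ϱ ^ (M + k) * ϱ ^ n := by
    intro M k h n
    have := hstep (n + M) k (by omega)
    rw [hpow] at this
    rw [show n + 1 + M = n + M + 1 by ring]
    refine this.trans (le_of_eq ?_)
    rw [show n + M + k = (M + k) + n by ring, pow_add _ (M + k)]
    ring
  have hlim : ∀ k, ∃ l, Tendsto (fun m => logPred Q g χ y m k) atTop (𝓝 l) := fun k => by
    obtain ⟨l, hl⟩ := cauchySeq_tendsto_of_complete
      (cauchySeq_of_le_geometric ϱ _ hϱ1 (hgeo N₀ k (Nat.le_add_right _ _)))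
    exact ⟨l, (tendsto_add_atTop_iff_nat N₀).1 hl⟩
  choose l hl using hlim
  refine ⟨l, hl, ?_⟩
  refine squeeze_zero_norm' (a := fun k => 4 * ϱ ^ k / (1 - ϱ)) ?_ ?_
  · filter_upwards [eventually_ge_atTop N₀] with k hk
    have := dist_le_of_le_geometric_of_tendsto₀ ϱ _ hϱ1 (hgeo 0 k (by omega)) (hl k)
    simp only [Real.dist_eq, zero_add] at this
    exact this
  · have := ((tendsto_pow_atTop_nhds_zero_of_lt_one hϱ0.le hϱ1).const_mul 4).div_const (1 - ϱ)
    simpa using this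

/-- Forgetting applied to two initial laws at the same time `-m`: the limit does not depend on the
law. -/
theorem RegularPath.tendsto_logPred_sub [MeasurableSpace 𝓨]
    (hg : Measurable (Function.uncurry g)) {K : Set (Fin r → 𝓨)} {D : Set 𝓧} {c A : ℝ}
    (hreg : RegularPath Q g K D y φ c A) (hc : 0 ≤ c) (hr : 1 ≤ r) (hD : MeasurableSet D)
    (hK : HasDoeblinBlocks Q g K) {χ χ' : Measure 𝓧} [IsProbabilityMeasure χ]
    [IsProbabilityMeasure χ'] (hχ : ChargesD Q g r D y φ χ) (hχ' : ChargesD Q g r D y φ χ') :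
    Tendsto (fun m => logPred Q g χ y m 0 - logPred Q g χ' y m 0) atTop (𝓝 0) := by
  have hA : 0 ≤ A := by
    have := hreg.sum_le 0 0
    simpa [windowSum] using this
  obtain ⟨α, hα, N₀, hN₀⟩ := hreg.exists_abs_logLik_sub_le hg hc hr hK
    (B₀ := 4 * c) (B₁ := 2 * (c * (1 + r) + A)) (by positivity)
  refine squeeze_zero_norm' (a := fun m : ℕ => 4 * Real.exp (-(α * m))) ?_ ?_
  · filter_upwards [eventually_ge_atTop N₀] with m hm
    refine hN₀ m m le_rfl hm χ χ' ?_
    have hμ : ∀ μ : Measure 𝓧, IsProbabilityMeasure μ → ChargesD Q g r D y φ μ →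
        μ Set.univ ≤ expE (4 * c * m + 2 * (c * (1 + r) + A)) ∧
        expE (-(4 * c * m + 2 * (c * (1 + r) + A))) ≤ ∫⁻ x, windowLik Q g y (-m) m x ∂μ ∧
        expE (-(4 * c * m + 2 * (c * (1 + r) + A)))
          ≤ ∫⁻ x, windowLik Q g y (-m) (m + 1) x ∂μ := by
      intro μ _ hμ
      refine ⟨?_, (expE_le.2 ?_).trans (hreg.expE_le_lintegral hg hr hD hμ m _),
          (expE_le.2 ?_).trans (hreg.expE_le_lintegral hg hr hD hμ m _)⟩
      · rw [measure_univ, ← expE_zero, expE_le]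
        positivity
      · linarith
      · push_cast; linarith
    rintro μ (rfl | rfl)
    · exact hμ _ inferInstance hχ
    · exact hμ _ inferInstance hχ'
  · have h1 : Tendsto (fun m : ℕ => α * (m : ℝ)) atTop atTop :=
      tendsto_natCast_atTop_atTop.const_mul_atTop hα
    have := (Real.tendsto_exp_neg_atTop_nhds_zero.comp h1).const_mul 4
    simpa using this

end Forgetting

/-! ### From logarithmic moments to exponential bounds. -/

section LogBounds

theorem log_expE (a : ℝ) : ENNReal.log (expE a) = a := by
  rw [expE, ENNReal.log_ofReal_of_pos (Real.exp_pos a), Real.log_exp]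

theorem le_coe_toENNReal (a : EReal) : a ≤ (a.toENNReal : EReal) := by
  rw [EReal.coe_toENNReal_eq_max]
  exact le_max_right _ _

theorem le_expE_of_lnPos_le {a : ℝ≥0∞} {b : ℝ} (hb : 0 ≤ b) (h : lnPos a ≤ ENNReal.ofReal b) :
    a ≤ expE b := by
  rw [← ENNReal.log_le_log_iff, log_expE]
  refine (le_coe_toENNReal _).trans ((EReal.coe_ennreal_le_coe_ennreal_iff.2 h).trans ?_)
  rw [EReal.coe_ennreal_ofReal, max_eq_left hb]

theorem expE_neg_le_of_lnNeg_le {a : ℝ≥0∞} {b : ℝ} (hb : 0 ≤ b) (h : lnNeg a ≤ ENNReal.ofReal b) :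
    expE (-b) ≤ a := by
  rw [← ENNReal.log_le_log_iff, log_expE, EReal.coe_neg]
  refine EReal.neg_le_of_neg_le ?_
  refine (le_coe_toENNReal _).trans ((EReal.coe_ennreal_le_coe_ennreal_iff.2 h).trans ?_)
  rw [EReal.coe_ennreal_ofReal, max_eq_left hb]

theorem FiniteMean.exists_integrable {S T : Type*} [MeasurableSpace S] [MeasurableSpace T]
    {ν : Measure S} {p : S → T} (hp : Measurable p) {F : T → ℝ≥0∞} (h : FiniteMean (ν.map p) F) :
    ∃ Φ : S → ℝ, Measurable Φ ∧ Integrable Φ ν ∧ 0 ≤ Φ ∧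
      ∀ᵐ s ∂ν, F (p s) ≤ ENNReal.ofReal (Φ s) := by
  obtain ⟨H, hH, hle, hfin⟩ := h
  rw [lintegral_map hH hp] at hfin
  have hm : Measurable fun s => H (p s) := hH.comp hp
  refine ⟨fun s => (H (p s)).toReal, hm.ennreal_toReal,
    integrable_toReal_of_lintegral_ne_top hm.aemeasurable hfin.ne, fun _ => ENNReal.toReal_nonneg,
    ?_⟩
  filter_upwards [ae_of_ae_map hp.aemeasurable hle, ae_lt_top hm hfin.ne] with s h1 h2
  rwa [ENNReal.ofReal_toReal h2.ne]

end LogBounds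

/-! ### The shift and two-sided ergodic bounds. -/

section Shift

variable {𝓨 : Type*}

/-- The shift by `j` on two-sided sequences. -/
def shiftBy (j : ℤ) (y : ℤ → 𝓨) : ℤ → 𝓨 := fun k => y (k + j)

theorem block_shiftBy (j : ℤ) (y : ℤ → 𝓨) (i : ℤ) (t : ℕ) :
    block (shiftBy j y) i t = block y (i + j) t := by
  funext k
  simp only [block, shiftBy]
  congr 1
  ring

theorem shiftBy_shiftBy (i j : ℤ) (y : ℤ → 𝓨) : shiftBy i (shiftBy j y) = shiftBy (i + j) y := by
  funext k
  simp only [shiftBy, add_assoc]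

theorem shift_iterate (n : ℕ) (y : ℤ → 𝓨) : shift^[n] y = shiftBy n y := by
  induction n generalizing y with
  | zero => funext k; simp [shiftBy]
  | succ n ih =>
    rw [Function.iterate_succ_apply, ih]
    funext k
    simp only [shiftBy, shift]
    congr 1
    push_cast
    ring

variable [MeasurableSpace 𝓨]

theorem measurable_shiftBy (j : ℤ) : Measurable (shiftBy j : (ℤ → 𝓨) → (ℤ → 𝓨)) :=
  measurable_pi_lambda _ fun _ => measurable_pi_apply _

theorem measurable_block (i : ℤ) (t : ℕ) : Measurable fun y : ℤ → 𝓨 => block y i t :=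
  measurable_pi_lambda _ fun _ => measurable_pi_apply _

/-- The shift as a measurable equivalence. -/
def shiftEquiv : (ℤ → 𝓨) ≃ᵐ (ℤ → 𝓨) where
  toFun := shift
  invFun := shiftBy (-1)
  left_inv y := by funext k; simp [shift, shiftBy]
  right_inv y := by funext k; simp [shift, shiftBy]
  measurable_toFun := measurable_shiftBy 1
  measurable_invFun := measurable_shiftBy (-1)

theorem shiftEquiv_symm_iterate (n : ℕ) (y : ℤ → 𝓨) :
    (shiftEquiv.symm : (ℤ → 𝓨) → (ℤ → 𝓨))^[n] y = shiftBy (-n) y := by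
  induction n generalizing y with
  | zero => funext k; simp [shiftBy]
  | succ n ih =>
    rw [Function.iterate_succ_apply, ih]
    change shiftBy _ (shiftBy (-1) y) = _
    rw [shiftBy_shiftBy]
    congr 1
    push_cast
    ring

variable {ν : Measure (ℤ → 𝓨)}

theorem ergodic_shiftEquiv_symm (hν : Ergodic shift ν) :
    Ergodic (shiftEquiv.symm : (ℤ → 𝓨) → (ℤ → 𝓨)) ν :=
  Ergodic.symm (e := shiftEquiv) hν

theorem measurePreserving_shiftBy (hν : Ergodic shift ν) (j : ℤ) :
    MeasurePreserving (shiftBy j) ν ν := by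
  obtain ⟨n, rfl | rfl⟩ := j.eq_nat_or_neg
  · have := hν.toMeasurePreserving.iterate n
    rwa [show (shift : (ℤ → 𝓨) → (ℤ → 𝓨))^[n] = shiftBy n from funext (shift_iterate n)] at this
  · have := (ergodic_shiftEquiv_symm hν).toMeasurePreserving.iterate n
    rwa [show (shiftEquiv.symm : (ℤ → 𝓨) → (ℤ → 𝓨))^[n] = shiftBy (-n) from
      funext (shiftEquiv_symm_iterate n)] at this

theorem ae_forall_shiftBy (hν : Ergodic shift ν) {p : (ℤ → 𝓨) → Prop} (h : ∀ᵐ y ∂ν, p y) :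
    ∀ᵐ y ∂ν, ∀ j, p (shiftBy j y) :=
  ae_all_iff.2 fun j => (measurePreserving_shiftBy hν j).quasiMeasurePreserving.ae h

/-- Two-sided upper half of the ergodic theorem for the shift. -/
theorem ae_windowSum_le [IsProbabilityMeasure ν] (hν : Ergodic shift ν) {ψ : (ℤ → 𝓨) → ℝ}
    (hψm : Measurable ψ) (hψ : Integrable ψ ν) {c : ℝ} (hc : ∫ y, ψ y ∂ν < c) :
    ∀ᵐ y ∂ν, ∃ A, ∀ m N : ℕ, m ≤ N →
      windowSum (fun j => ψ (shiftBy j y)) (-m) N ≤ c * N + A := by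
  have hpres := measurePreserving_shiftBy hν (-1)
  have hback : ∫ y, ψ (shiftBy (-1) y) ∂ν < c := by
    have h1 := integral_map (μ := ν) hpres.measurable.aemeasurable
      (f := ψ) hψm.aestronglyMeasurable
    rwa [← h1, hpres.map_eq]
  filter_upwards [ae_birkhoffSum_le hν hψm hψ hc,
    ae_birkhoffSum_le (ergodic_shiftEquiv_symm hν) (hψm.comp hpres.measurable)
      (hpres.integrable_comp_of_integrable hψ) hback] with y ⟨A, hA⟩ ⟨B, hB⟩
  refine ⟨A + B, fun m N hmN => ?_⟩
  -- Since `m ≤ N` the window splits at time 0 into a forward sum for the shift and a backward sum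
  -- for its inverse. The latter starts at time -1, hence `ψ` composed with one inverse shift.
  obtain ⟨n, rfl⟩ := Nat.exists_eq_add_of_le hmN
  rw [windowSum_add]
  have h1 : windowSum (fun j => ψ (shiftBy j y)) (-(m : ℤ) + m) n ≤ c * n + A := by
    refine le_trans (le_of_eq ?_) (hA n)
    simp only [windowSum, birkhoffSum, shift_iterate, neg_add_cancel, zero_add]
  have h2 : windowSum (fun j => ψ (shiftBy j y)) (-(m : ℤ)) m ≤ c * m + B := by
    refine le_trans (le_of_eq ?_) (hB m)
    simp only [windowSum, birkhoffSum, shiftEquiv_symm_iterate, Function.comp_apply]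
    rw [← Finset.sum_range_reflect]
    refine Finset.sum_congr rfl fun k hk => ?_
    have hk' := Finset.mem_range.1 hk
    rw [shiftBy_shiftBy, show ((m - 1 - k : ℕ) : ℤ) = m - 1 - k by omega]
    ring_nf
  push_cast
  linarith

end Shift

/-! ### Integrability from Birkhoff sums. -/

section Integrability

variable {α : Type*} [MeasurableSpace α] {μ : Measure α}

/-- A function bounded above by an integrable function is integrable if its Birkhoff sums decrease
at most linearly. -/
theorem integrable_of_birkhoffSum_ge [IsProbabilityMeasure μ] {T : α → α} (hT : Ergodic T μ)
    {f F : α → ℝ} (hfm : Measurable f) (hF : Integrable F μ) (hle : ∀ᵐ x ∂μ, f x ≤ F x) {c : ℝ}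
    (hge : ∀ᵐ x ∂μ, ∀ᶠ n : ℕ in atTop, c * n ≤ birkhoffSum T f n x) : Integrable f μ := by
  have hint : ∀ M : ℕ, Integrable (fun x => max (f x) (-M)) μ := fun M => by
    refine Integrable.mono' (hF.abs.add (integrable_const (M : ℝ)))
      (hfm.max measurable_const).aestronglyMeasurable ?_
    filter_upwards [hle] with x hx
    have hM : (0 : ℝ) ≤ M := M.cast_nonneg
    rw [Real.norm_eq_abs, abs_le, Pi.add_apply]
    refine ⟨?_, max_le ?_ ?_⟩
    · exact le_trans (by linarith [abs_nonneg (F x)]) (le_max_right _ _)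
    · linarith [le_abs_self (F x)]
    · linarith [abs_nonneg (F x)]
  -- A single path suffices: the truncated Birkhoff averages converge there to the integral and are
  -- eventually at least `c`. Fatou's lemma then removes the truncation.
  have hlow : ∀ M : ℕ, c ≤ ∫ x, max (f x) (-M) ∂μ := fun M => by
    obtain ⟨x, hx1, hx2⟩ := ((ae_tendsto_birkhoffSum_div hT (hfm.max measurable_const)
      (hint M)).and hge).exists
    refine ge_of_tendsto hx1 ?_
    filter_upwards [hx2, eventually_gt_atTop 0] with n hn hn0
    have hn0' : (0 : ℝ) < n := by exact_mod_cast hn0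
    rw [le_div_iff₀ hn0']
    exact hn.trans (Finset.sum_le_sum fun k _ => le_max_left _ _)
  have hlim : ∀ᵐ x ∂μ, ENNReal.ofReal (F x - f x)
      ≤ liminf (fun M : ℕ => ENNReal.ofReal (F x - max (f x) (-M))) atTop := by
    refine Eventually.of_forall fun x => ?_
    have : Tendsto (fun M : ℕ => ENNReal.ofReal (F x - max (f x) (-M))) atTop
        (𝓝 (ENNReal.ofReal (F x - f x))) := by
      refine tendsto_const_nhds.congr' ?_
      filter_upwards [tendsto_natCast_atTop_atTop.eventually_ge_atTop (-f x)] with M hM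
      rw [max_eq_left (by linarith)]
    exact this.liminf_eq.ge
  have hFm := hF.aestronglyMeasurable.aemeasurable
  have hbound : ∫⁻ x, ENNReal.ofReal (F x - f x) ∂μ ≤ ENNReal.ofReal (∫ x, |F x| ∂μ - c) := by
    have hMle : ∀ M : ℕ, ∀ᵐ x ∂μ, 0 ≤ |F x| - max (f x) (-M) := fun M => by
      filter_upwards [hle] with x hx
      rw [sub_nonneg]
      refine max_le (hx.trans (le_abs_self _)) ?_
      linarith [abs_nonneg (F x), (M.cast_nonneg : (0 : ℝ) ≤ M)]
    calc ∫⁻ x, ENNReal.ofReal (F x - f x) ∂μ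
        ≤ ∫⁻ x, liminf (fun M : ℕ => ENNReal.ofReal (F x - max (f x) (-M))) atTop ∂μ :=
          lintegral_mono_ae hlim
      _ ≤ liminf (fun M : ℕ => ∫⁻ x, ENNReal.ofReal (F x - max (f x) (-M)) ∂μ) atTop :=
          lintegral_liminf_le' fun M =>
            (hFm.sub (hfm.max measurable_const).aemeasurable).ennreal_ofReal
      _ ≤ ENNReal.ofReal (∫ x, |F x| ∂μ - c) := by
          refine liminf_le_of_le (by isBoundedDefault) fun b hb => ?_
          obtain ⟨M, hM⟩ := hb.exists
          refine hM.trans ?_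
          calc ∫⁻ x, ENNReal.ofReal (F x - max (f x) (-M)) ∂μ
              ≤ ∫⁻ x, ENNReal.ofReal (|F x| - max (f x) (-M)) ∂μ :=
                lintegral_mono fun x => ENNReal.ofReal_le_ofReal
                  (sub_le_sub_right (le_abs_self _) _)
            _ = ENNReal.ofReal (∫ x, (|F x| - max (f x) (-M)) ∂μ) :=
                (ofReal_integral_eq_lintegral_ofReal (hF.abs.sub (hint M)) (hMle M)).symm
            _ ≤ _ := by
                rw [integral_sub hF.abs (hint M)]
                exact ENNReal.ofReal_le_ofReal (sub_le_sub_left (hlow M) _)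
  have hdiff : Integrable (fun x => F x - f x) μ := by
    refine ⟨(hFm.sub hfm.aemeasurable).aestronglyMeasurable, ?_⟩
    rw [hasFiniteIntegral_iff_ofReal (by filter_upwards [hle] with x hx; exact sub_nonneg.2 hx)]
    exact hbound.trans_lt ENNReal.ofReal_lt_top
  exact (hF.sub hdiff).congr (Eventually.of_forall fun x => by simp)

end Integrability

/-! ### Regularity of almost every path. -/

section Weights

variable {Θ 𝓧 𝓨 Ω : Type*} [MeasurableSpace 𝓧] [MeasurableSpace 𝓨] [MeasurableSpace Ω]

theorem blockLaw_eq_map {P : Measure Ω} {Y : ℤ → Ω → 𝓨} (hY : ∀ k, Measurable (Y k)) (t : ℕ) :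
    blockLaw P Y t = (P.map fun ω k => Y k ω).map fun y => block y 0 t := by
  rw [Measure.map_map (measurable_block 0 t) (measurable_pi_lambda _ hY)]
  rfl

/-- Almost every path is regular, with an integrable weight. -/
theorem exists_weight {Q : Θ → Kernel 𝓧 𝓧} {g : Θ → 𝓧 → 𝓨 → ℝ≥0} {P : Measure Ω}
    [IsProbabilityMeasure P] {Y : ℤ → Ω → 𝓨} (hY : IsStationaryErgodic P Y) {r : ℕ}
    {K : Set (Fin r → 𝓨)} {D : Set 𝓧} (hA1 : AssumptionA1 Q g P Y r K D)
    (hA2 : AssumptionA2 g P Y) (θ : Θ) {χ χ' : ProbabilityMeasure 𝓧}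
    (hχ : χ ∈ initialClass Q g P Y D r) (hχ' : χ' ∈ initialClass Q g P Y D r) :
    ∃ (Φ : (ℤ → 𝓨) → ℝ) (c : ℝ), Integrable Φ (P.map fun ω k => Y k ω) ∧ 0 ≤ c ∧
      ∀ᵐ y ∂(P.map fun ω k => Y k ω),
        (∃ A, RegularPath (Q θ) (g θ) K D y (fun j => Φ (shiftBy j y)) c A) ∧
        ChargesD (Q θ) (g θ) r D y (fun j => Φ (shiftBy j y)) (χ : Measure 𝓧) ∧
        ChargesD (Q θ) (g θ) r D y (fun j => Φ (shiftBy j y)) (χ' : Measure 𝓧) := by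
  have hYm : Measurable fun (ω : Ω) (k : ℤ) => Y k ω := measurable_pi_lambda _ hY.1
  set ν := P.map fun ω k => Y k ω with hν
  have hνp : IsProbabilityMeasure ν := Measure.isProbabilityMeasure_map hYm.aemeasurable
  have herg : Ergodic shift ν := hY.2
  have hr := hA1.one_le
  have h₁ := hA2.lnPos_sup
  rw [show P.map (Y 0) = ν.map fun y => y 0 by
    rw [hν, Measure.map_map (measurable_pi_apply _) hYm]; rfl] at h₁
  have h₂ := hA1.minoration
  have h₃ := hχ r (Finset.mem_Icc.2 ⟨hr, le_rfl⟩)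
  have h₄ := hχ' r (Finset.mem_Icc.2 ⟨hr, le_rfl⟩)
  rw [blockLaw_eq_map hY.1] at h₂ h₃ h₄
  obtain ⟨Φ₁, m₁, i₁, p₁, b₁⟩ := h₁.exists_integrable (measurable_pi_apply _)
  obtain ⟨Φ₂, m₂, i₂, p₂, b₂⟩ := h₂.exists_integrable (measurable_block _ _)
  obtain ⟨Φ₃, m₃, i₃, p₃, b₃⟩ := h₃.exists_integrable (measurable_block _ _)
  obtain ⟨Φ₄, m₄, i₄, p₄, b₄⟩ := h₄.exists_integrable (measurable_block _ _)
  -- One weight dominates all four logarithmic quantities, so every bound on a path uses the same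
  -- `φ`.
  set Φ : (ℤ → 𝓨) → ℝ := fun y => Φ₁ y + Φ₂ y + Φ₃ y + Φ₄ y with hΦ
  have hΦm : Measurable Φ := ((m₁.add m₂).add m₃).add m₄
  have hΦi : Integrable Φ ν := ((i₁.add i₂).add i₃).add i₄
  have p₁' : ∀ y, 0 ≤ Φ₁ y := p₁
  have p₂' : ∀ y, 0 ≤ Φ₂ y := p₂
  have p₃' : ∀ y, 0 ≤ Φ₃ y := p₃
  have p₄' : ∀ y, 0 ≤ Φ₄ y := p₄
  have hΦ0 : ∀ y, 0 ≤ Φ y := fun y => by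
    linarith [p₁' y, p₂' y, p₃' y, p₄' y]
  have c₁ : ∀ y, Φ₁ y ≤ Φ y := fun y => by linarith [p₂' y, p₃' y, p₄' y]
  have c₂ : ∀ y, Φ₂ y ≤ Φ y := fun y => by linarith [p₁' y, p₃' y, p₄' y]
  have c₃ : ∀ y, Φ₃ y ≤ Φ y := fun y => by linarith [p₁' y, p₂' y, p₄' y]
  have c₄ : ∀ y, Φ₄ y ≤ Φ y := fun y => by linarith [p₁' y, p₂' y, p₃' y]
  have hKm : Measurable fun y : ℤ → 𝓨 => Kᶜ.indicator (1 : (Fin r → 𝓨) → ℝ) (block y 0 r) :=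
    (measurable_one.indicator hA1.measurableSet_K.compl).comp (measurable_block 0 r)
  have hKi : Integrable (fun y : ℤ → 𝓨 => Kᶜ.indicator (1 : (Fin r → 𝓨) → ℝ) (block y 0 r)) ν := by
    refine Integrable.of_bound hKm.aestronglyMeasurable 1 (Eventually.of_forall fun y => ?_)
    by_cases h : block y 0 r ∈ K <;> simp [h]
  have hKlt : ∫ y, Kᶜ.indicator (1 : (Fin r → 𝓨) → ℝ) (block y 0 r) ∂ν < 1 / 3 := by
    have hpre : MeasurableSet ((fun y : ℤ → 𝓨 => block y 0 r) ⁻¹' K) :=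
      measurable_block 0 r hA1.measurableSet_K
    have h1 : ∫ y, Kᶜ.indicator (1 : (Fin r → 𝓨) → ℝ) (block y 0 r) ∂ν
        = ν.real ((fun y : ℤ → 𝓨 => block y 0 r) ⁻¹' K)ᶜ := by
      rw [← integral_indicator_one hpre.compl]
      rfl
    have h2 : (2 : ℝ) / 3 < ν.real ((fun y : ℤ → 𝓨 => block y 0 r) ⁻¹' K) := by
      have h3 : ν ((fun y : ℤ → 𝓨 => block y 0 r) ⁻¹' K)
          = P {ω | block (fun k => Y k ω) 0 r ∈ K} := Measure.map_apply hYm hpre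
      have h4 := hA1.prob_K
      rw [← h3] at h4
      have h5 := (ENNReal.toReal_lt_toReal (by finiteness) (measure_ne_top _ _)).2 h4
      simpa [Measure.real] using h5
    rw [h1, probReal_compl_eq_one_sub hpre]
    linarith
  refine ⟨Φ, ∫ y, Φ y ∂ν + 1, hΦi, add_nonneg (integral_nonneg hΦ0) zero_le_one, ?_⟩
  filter_upwards [ae_forall_shiftBy herg b₁, ae_forall_shiftBy herg b₂, ae_forall_shiftBy herg b₃,
    ae_forall_shiftBy herg b₄, ae_windowSum_le herg hΦm hΦi (lt_add_one _),
    ae_windowSum_le herg hKm hKi hKlt] with y e₁ e₂ e₃ e₄ ⟨A, hA⟩ ⟨B, hB⟩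
  simp only [block_shiftBy, zero_add] at e₂ e₃ e₄ hB
  have hmono : ∀ {a b : ℝ}, a ≤ b → ENNReal.ofReal a ≤ ENNReal.ofReal b :=
    fun h => ENNReal.ofReal_le_ofReal h
  refine ⟨⟨max A B, ⟨fun j => hΦ0 _, fun j x => ?_, fun j x hx => ?_, fun m N => ?_,
    fun m N hmN => ?_⟩⟩, fun i => ?_, fun i => ?_⟩
  · refine le_trans ?_ (le_expE_of_lnPos_le (hΦ0 _) ((e₁ j).trans (hmono (c₁ _))))
    have : shiftBy j y 0 = y j := by simp [shiftBy]
    rw [this]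
    exact le_iSup₂ (f := fun θ x => (g θ x (y j) : ℝ≥0∞)) θ x
  · refine (expE_neg_le_of_lnNeg_le (hΦ0 _) ((e₂ j).trans (hmono (c₂ _)))).trans ?_
    exact (iInf_le _ θ).trans (iInf₂_le x hx)
  -- The ergodic bound needs a window reaching time 0; as `Φ ≥ 0`, the window may be lengthened to
  -- `m + N`.
  · refine (windowSum_mono (fun j => hΦ0 _) _ (Nat.le_add_left N m)).trans ?_
    have := hA m (m + N) (Nat.le_add_right _ _)
    push_cast at this
    linarith [le_max_left A B]
  · have := hB m N hmN
    linarith [le_max_right A B]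
  · exact (expE_neg_le_of_lnNeg_le (hΦ0 _) ((e₃ i).trans (hmono (c₃ _)))).trans (iInf_le _ θ)
  · exact (expE_neg_le_of_lnNeg_le (hΦ0 _) ((e₄ i).trans (hmono (c₄ _)))).trans (iInf_le _ θ)

end Weights

/-! ### The limiting predictive density as a measurable function of the past. -/

section Limit

variable {𝓧 𝓨 : Type*} [MeasurableSpace 𝓧]

/-- Extension of a sequence indexed by the nonpositive integers to a two-sided sequence. -/
def extendPast (w : Set.Iic (0 : ℤ) → 𝓨) : ℤ → 𝓨 := fun k => w ⟨min k 0, min_le_right k 0⟩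

theorem predictive_extendPast (Q : Kernel 𝓧 𝓧) (g : 𝓧 → 𝓨 → ℝ≥0) (χ : Measure 𝓧) (y : ℤ → 𝓨)
    (m : ℕ) : predictive Q g χ (extendPast fun k => y k) m = predictive Q g χ y m := by
  have h : ∀ t ≤ m + 1, block (extendPast fun k => y k) (-(m : ℤ)) t = block y (-(m : ℤ)) t := by
    intro t ht
    funext k
    have hk := k.2
    simp only [block, extendPast]
    congr 1
    exact min_eq_left (by omega)
  rw [predictive, predictive, h _ le_rfl, h _ (Nat.le_succ m)]

/-- The limiting predictive density, as a function of the past. -/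
def limitPredictive (Q : Kernel 𝓧 𝓧) (g : 𝓧 → 𝓨 → ℝ≥0) (χ : Measure 𝓧)
    (w : Set.Iic (0 : ℤ) → 𝓨) : ℝ :=
  (limsup (fun m => predictive Q g χ (extendPast w) m) atTop).toReal

theorem continuous_expE : Continuous expE := ENNReal.continuous_ofReal.comp Real.continuous_exp

theorem limitPredictive_eq {Q : Kernel 𝓧 𝓧} {g : 𝓧 → 𝓨 → ℝ≥0} {χ : Measure 𝓧} {y : ℤ → 𝓨} {l : ℝ}
    (hpred : ∀ m, predictive Q g χ y m = expE (logPred Q g χ y m 0))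
    (hl : Tendsto (fun m => logPred Q g χ y m 0) atTop (𝓝 l)) :
    limitPredictive Q g χ (fun k => y k) = Real.exp l := by
  have h : Tendsto (fun m => expE (logPred Q g χ y m 0)) atTop (𝓝 (expE l)) :=
    (continuous_expE.tendsto l).comp hl
  rw [limitPredictive]
  simp_rw [predictive_extendPast, hpred]
  rw [h.limsup_eq, expE, ENNReal.toReal_ofReal (Real.exp_pos _).le]

theorem logPred_shiftBy (Q : Kernel 𝓧 𝓧) (g : 𝓧 → 𝓨 → ℝ≥0) (χ : Measure 𝓧) (y : ℤ → 𝓨)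
    (m k : ℕ) : logPred Q g χ (shiftBy k y) (m + k) 0 = logPred Q g χ y m k := by
  simp only [logPred, logLik, windowLik, block_shiftBy]
  rw [show -((m + k : ℕ) : ℤ) + k = -(m : ℤ) by push_cast; ring]
  rfl

variable [MeasurableSpace 𝓨]

theorem measurable_extendPast : Measurable (extendPast : (Set.Iic (0 : ℤ) → 𝓨) → ℤ → 𝓨) :=
  measurable_pi_lambda _ fun _ => measurable_pi_apply _

theorem measurable_predictive (Q : Kernel 𝓧 𝓧) [IsMarkovKernel Q] {g : 𝓧 → 𝓨 → ℝ≥0}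
    (hg : Measurable (Function.uncurry g)) (χ : Measure 𝓧) [SFinite χ] (m : ℕ) :
    Measurable fun y : ℤ → 𝓨 => predictive Q g χ y m := by
  have h : ∀ t i, Measurable fun y : ℤ → 𝓨 => likelihood Q g χ (block y i t) := by
    intro t i
    simp_rw [likelihood, likelihoodFrom_eq_blockOp]
    exact (measurable_blockOp_prod Q hg t measurable_one).lintegral_prod_right'.comp
      (measurable_block i t)
  exact (h _ _).div (h _ _)

theorem measurable_limitPredictive (Q : Kernel 𝓧 𝓧) [IsMarkovKernel Q] {g : 𝓧 → 𝓨 → ℝ≥0}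
    (hg : Measurable (Function.uncurry g)) (χ : Measure 𝓧) [SFinite χ] :
    Measurable (limitPredictive Q g χ) :=
  (Measurable.limsup fun m =>
    (measurable_predictive Q hg χ m).comp measurable_extendPast).ennreal_toReal

end Limit

/-! ### Almost sure convergence of predictive densities. -/

section Limit

variable {Θ 𝓧 𝓨 Ω : Type*} [MeasurableSpace 𝓧] [MeasurableSpace 𝓨] [MeasurableSpace Ω]

/-- For `χ₀`, `χ` in the class of initial distributions, the predictive log-densities for `χ`
converge almost surely along the past to the limit obtained for `χ₀`, and are asymptotic to it along
the future. -/
theorem ae_logPred {Q : Θ → Kernel 𝓧 𝓧} (hQ : ∀ θ, IsMarkovKernel (Q θ)) {g : Θ → 𝓧 → 𝓨 → ℝ≥0}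
    (hg : ∀ θ, Measurable (Function.uncurry (g θ))) {P : Measure Ω}
    [IsProbabilityMeasure P] {Y : ℤ → Ω → 𝓨} (hY : IsStationaryErgodic P Y) {r : ℕ}
    {K : Set (Fin r → 𝓨)} {D : Set 𝓧} (hA1 : AssumptionA1 Q g P Y r K D)
    (hA2 : AssumptionA2 g P Y) (θ : Θ) {χ₀ χ : ProbabilityMeasure 𝓧}
    (hχ₀ : χ₀ ∈ initialClass Q g P Y D r) (hχ : χ ∈ initialClass Q g P Y D r) :
    ∃ (Φ : (ℤ → 𝓨) → ℝ) (c : ℝ), Integrable Φ (P.map fun ω k => Y k ω) ∧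
      ∀ᵐ y ∂(P.map fun ω k => Y k ω),
        0 < limitPredictive (Q θ) (g θ) (χ₀ : Measure 𝓧) (fun k => y k) ∧
        Real.log (limitPredictive (Q θ) (g θ) (χ₀ : Measure 𝓧) (fun k => y k)) ≤ Φ y ∧
        Tendsto (fun m => predictive (Q θ) (g θ) (χ : Measure 𝓧) y m) atTop
          (𝓝 (ENNReal.ofReal (limitPredictive (Q θ) (g θ) (χ₀ : Measure 𝓧) (fun k => y k)))) ∧
        Tendsto (fun k : ℕ => logPred (Q θ) (g θ) (χ : Measure 𝓧) y 0 k
          - Real.log (limitPredictive (Q θ) (g θ) (χ₀ : Measure 𝓧) (fun j => shiftBy k y j)))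
          atTop (𝓝 0) ∧
        (∀ n : ℕ, ENNReal.log (likelihood (Q θ) (g θ) (χ : Measure 𝓧) (block y 0 n))
          = (logLik (Q θ) (g θ) (χ : Measure 𝓧) y 0 n : EReal)) ∧
        ∃ B, ∀ n : ℕ, -(c * n + B) ≤ logLik (Q θ) (g θ) (χ : Measure 𝓧) y 0 n := by
  obtain ⟨Φ, c, hΦ, hc, hae⟩ := exists_weight hY hA1 hA2 θ hχ₀ hχ
  have := hQ θ
  have hK := hasDoeblinBlocks_of_forall_isLocalDoeblin hQ hg hA1.localDoeblin θ
  have hr := hA1.one_le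
  have hD := hA1.measurableSet_D
  set Λ : (ℤ → 𝓨) → ℝ := fun y =>
    limitPredictive (Q θ) (g θ) (χ₀ : Measure 𝓧) (fun k => y k) with hΛ
  have hlim : ∀ᵐ y ∂(P.map fun ω k => Y k ω), ∃ l : ℝ, Λ y = Real.exp l ∧
      Tendsto (fun m => logPred (Q θ) (g θ) (χ : Measure 𝓧) y m 0) atTop (𝓝 l) := by
    filter_upwards [hae] with y ⟨⟨A, hreg⟩, h₀, h₁⟩
    obtain ⟨l, hl, -⟩ := hreg.exists_limit_logPred (hg θ) hc hr hD hK h₀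
    refine ⟨l 0, limitPredictive_eq (hreg.expE_logPred (hg θ) hr hD h₀) (hl 0), ?_⟩
    have := (hl 0).add (hreg.tendsto_logPred_sub (hg θ) hc hr hD hK h₁ h₀)
    simpa using this
  refine ⟨Φ, 2 * c, hΦ, ?_⟩
  filter_upwards [hae, ae_forall_shiftBy hY.2 hlim, hlim] with y ⟨⟨A, hreg⟩, h₀, h₁⟩ hsh
    ⟨l, hl, hlt⟩
  have hpos : ∀ n : ℕ, 0 < (∫⁻ x, windowLik (Q θ) (g θ) y 0 n x ∂(χ : Measure 𝓧)).toReal := fun n =>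
    ENNReal.toReal_pos (by simpa using (hreg.lintegral_pos (hg θ) hr hD h₁ 0 n).ne')
      (hreg.lintegral_ne_top _ _ n)
  refine ⟨(Real.exp_pos l).trans_eq hl.symm, ?_, ?_, ?_, fun n => ?_, 2 * (c * r + A), fun n => ?_⟩
  · change Real.log (Λ y) ≤ _
    rw [hl, Real.log_exp]
    refine le_of_tendsto' hlt fun m => (hreg.logPred_le (hg θ) hr hD h₁ m 0).trans (le_of_eq ?_)
    congr 1
    funext k
    simp [shiftBy]
  · change Tendsto _ _ (𝓝 (ENNReal.ofReal (Λ y)))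
    rw [hl]
    simp_rw [hreg.expE_logPred (hg θ) hr hD h₁]
    exact (continuous_expE.tendsto l).comp hlt
  -- The limit at time `k` is the limit at time 0 of the path shifted by `k`, so it can be evaluated
  -- through `Λ` at every shift.
  · obtain ⟨l', hl', hl0⟩ := hreg.exists_limit_logPred (hg θ) hc hr hD hK h₁
    refine hl0.congr fun k => ?_
    obtain ⟨s, hs, hst⟩ := hsh k
    have h2 : Tendsto (fun m => logPred (Q θ) (g θ) (χ : Measure 𝓧) y m k) atTop (𝓝 s) := by
      have := hst.comp (tendsto_add_atTop_nat k)
      refine this.congr fun m => ?_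
      exact logPred_shiftBy (Q θ) (g θ) _ y m k
    change _ = _ - Real.log (Λ (shiftBy k y))
    rw [hs, Real.log_exp, tendsto_nhds_unique (hl' k) h2]
  · rw [likelihood_block, ENNReal.log_pos_real' (hpos n)]
    rfl
  · have h2 := hreg.expE_le_lintegral (hg θ) hr hD h₁ 0 n
    have h3 := ENNReal.toReal_mono (hreg.lintegral_ne_top _ _ n) h2
    rw [expE, ENNReal.toReal_ofReal (Real.exp_pos _).le] at h3
    have h4 := Real.log_le_log (Real.exp_pos _) h3
    rw [Real.log_exp] at h4
    simp only [Nat.cast_zero, neg_zero] at h4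
    rw [logLik]
    linarith

end Limit

end

end HMM

/-! ### Assembly of the theorem. -/

open HMM in
theorem proposition1 {Θ 𝓧 𝓨 Ω : Type*} [MetricSpace Θ] [CompactSpace Θ]
    [MeasurableSpace 𝓧] [MeasurableSpace 𝓨] [MeasurableSpace Ω]
    (Q : Θ → Kernel 𝓧 𝓧) (hQ : ∀ θ, IsMarkovKernel (Q θ))
    (g : Θ → 𝓧 → 𝓨 → ℝ≥0) (hg : ∀ θ, Measurable (Function.uncurry (g θ)))
    (P : Measure Ω) (hP : IsProbabilityMeasure P)
    (Y : ℤ → Ω → 𝓨) (hY : HMM.IsStationaryErgodic P Y)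
    (r : ℕ) (K : Set (Fin r → 𝓨)) (D : Set 𝓧)
    (hA1 : HMM.AssumptionA1 Q g P Y r K D) (hA2 : HMM.AssumptionA2 g P Y) (θ : Θ) :
    ∃ π : (Set.Iic (0 : ℤ) → 𝓨) → ℝ, Measurable π ∧
      -- the predictive density converges to `π`, the same function for all `χ`
      (∀ χ ∈ HMM.initialClass Q g P Y D r, ∀ᵐ ω ∂P,
        Tendsto (fun m : ℕ => HMM.predictive (Q θ) (g θ) (χ : Measure 𝓧) (fun k => Y k ω) m)
          atTop (𝓝 (ENNReal.ofReal (π fun k => Y k ω)))) ∧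
      -- `𝔼 |ln π| < ∞`; in particular `π > 0` almost surely
      (∀ᵐ ω ∂P, 0 < π fun k => Y k ω) ∧
      Integrable (fun ω => Real.log (π fun k => Y k ω)) P ∧
      -- the normalized log-likelihood converges to `ℓ(θ) = 𝔼 [ln π]`
      (∀ χ ∈ HMM.initialClass Q g P Y D r, ∀ᵐ ω ∂P,
        Tendsto (fun n : ℕ =>
            ENNReal.log (HMM.likelihood (Q θ) (g θ) (χ : Measure 𝓧)
              (HMM.block (fun k => Y k ω) 0 n)) / (n : EReal))
          atTop (𝓝 ((∫ ω', Real.log (π fun k => Y k ω') ∂P : ℝ) : EReal))) := by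
  -- For an empty class of initial laws the convergence claims are vacuous, and the constant 1
  -- serves. Otherwise the limit is built from one chosen `χ₀`.
  by_cases hne : ∃ χ₀, χ₀ ∈ initialClass Q g P Y D r
  swap
  · push Not at hne
    exact ⟨fun _ => 1, measurable_const, fun χ hχ => absurd hχ (hne χ), by simp, by simp,
      fun χ hχ => absurd hχ (hne χ)⟩
  obtain ⟨χ₀, hχ₀⟩ := hne
  have := hQ θ
  have hYm : Measurable fun (ω : Ω) (k : ℤ) => Y k ω := measurable_pi_lambda _ hY.1
  set ν := P.map fun ω k => Y k ω with hν
  have hνp : IsProbabilityMeasure ν := Measure.isProbabilityMeasure_map hYm.aemeasurable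
  have herg : Ergodic shift ν := hY.2
  have hπm := measurable_limitPredictive (Q θ) (hg θ) (χ₀ : Measure 𝓧)
  set Λ : (ℤ → 𝓨) → ℝ := fun y =>
    Real.log (limitPredictive (Q θ) (g θ) (χ₀ : Measure 𝓧) (fun k => y k)) with hΛ
  have hΛm : Measurable Λ := Real.measurable_log.comp
    (hπm.comp (measurable_pi_lambda _ fun _ => measurable_pi_apply _))
  -- The log-likelihood is the sum of the log-predictive densities, so Cesàro's theorem compares it
  -- with the Birkhoff sums of `Λ`.
  have hsum : ∀ χ : ProbabilityMeasure 𝓧, ∀ y : ℤ → 𝓨,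
      Tendsto (fun k : ℕ => logPred (Q θ) (g θ) (χ : Measure 𝓧) y 0 k - Λ (shiftBy k y))
        atTop (𝓝 0) →
      Tendsto (fun n : ℕ => (logLik (Q θ) (g θ) (χ : Measure 𝓧) y 0 n - birkhoffSum shift Λ n y) / n)
        atTop (𝓝 0) := fun χ y h => by
    refine h.cesaro.congr fun n => ?_
    rw [Finset.sum_sub_distrib, sum_logPred]
    simp only [birkhoffSum, shift_iterate]
    ring
  have hΛi : Integrable Λ ν := by
    obtain ⟨Φ, c, hΦ, hae⟩ := ae_logPred hQ hg hY hA1 hA2 θ hχ₀ hχ₀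
    -- Beyond the rate `c` of the log-likelihood, one unit covers the Cesàro error and one covers
    -- the constant `B`, once `n ≥ B`.
    refine integrable_of_birkhoffSum_ge (c := -(c + 2)) herg hΛm hΦ ?_ ?_
    · filter_upwards [hae] with y hy
      exact hy.2.1
    · filter_upwards [hae] with y ⟨_, _, _, h, _, B, hB⟩
      filter_upwards [(hsum χ₀ y h).eventually (gt_mem_nhds one_pos), eventually_gt_atTop 0,
        tendsto_natCast_atTop_atTop.eventually_ge_atTop B] with n hn hn0 hnB
      have hn0' : (0 : ℝ) < n := by exact_mod_cast hn0
      rw [div_lt_iff₀ hn0'] at hn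
      linarith [hB n]
  refine ⟨limitPredictive (Q θ) (g θ) (χ₀ : Measure 𝓧), hπm, fun χ hχ => ?_, ?_, ?_,
    fun χ hχ => ?_⟩
  · obtain ⟨Φ, c, -, hae⟩ := ae_logPred hQ hg hY hA1 hA2 θ hχ₀ hχ
    filter_upwards [ae_of_ae_map hYm.aemeasurable hae] with ω hω
    exact hω.2.2.1
  · obtain ⟨Φ, c, -, hae⟩ := ae_logPred hQ hg hY hA1 hA2 θ hχ₀ hχ₀
    filter_upwards [ae_of_ae_map hYm.aemeasurable hae] with ω hω
    exact hω.1
  · exact hΛi.comp_measurable hYm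
  · obtain ⟨Φ, c, -, hae⟩ := ae_logPred hQ hg hY hA1 hA2 θ hχ₀ hχ
    have hint : ∫ ω, Real.log (limitPredictive (Q θ) (g θ) (χ₀ : Measure 𝓧) fun k => Y k ω) ∂P
        = ∫ y, Λ y ∂ν :=
      (integral_map hYm.aemeasurable hΛm.aestronglyMeasurable).symm
    filter_upwards [ae_of_ae_map hYm.aemeasurable hae, ae_of_ae_map hYm.aemeasurable
      (ae_tendsto_birkhoffSum_div herg hΛm hΛi)] with ω ⟨_, _, _, h, hlog, _⟩ hb
    rw [hint]
    have h1 := (hsum χ _ h).add hb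
    rw [zero_add] at h1
    refine ((continuous_coe_real_ereal.tendsto _).comp h1).congr fun n => ?_
    rw [hlog n, Function.comp_apply, ← add_div, sub_add_cancel, EReal.coe_div]
    rfl
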